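/- Let $f(x,\theta)$ be a real-valued mean function with $\theta\in\mathbb R^p$, let $x_1,x_2,\dots$ be fixed design points, $\theta_0\in\mathbb R^p$ the true parameter, and let $\epsilon_1,\epsilon_2,\dots$ be i.i.d. random variables with mean $0$ and variance $1$. For each sample size $n$ let $\sigma=\sigma_n>0$ and observe $y_i=f(x_i,\theta_0)(1+\sigma_n\epsilon_i)$, $i=1,\dots,n$. Write $f_i(\theta)=f(x_i,\theta)$. The weighted least squares (WLS) and data weighted least squares (DWLS) estimators are roots $\hat\theta=\hat\theta_n$ of, respectively, $$\sum_{i=1}^n\frac{y_i-f_i(\theta)}{f_i(\theta)^2}\nabla f_i(\theta)+\sum_{i=1}^n\frac{(y_i-f_i(\theta))^2}{f_i(\theta)^3}\nabla f_i(\theta)=0,\qquad \sum_{i=1}^n\frac{y_i-f_i(\theta)}{y_i^2}\nabla f_i(\theta)=0 .$$ Put $J_i=\nabla f_i(\theta_0)/f_i(\theta_0)$, $K_i=\nabla^2 f_i(\theta_0)/f_i(\theta_0)$ (relative gradient and Hessian), let $\mathbf J$ be the $n\times p$ matrix with rows $J_i^T$, and put $w_{1,i}=\operatorname{tr}\{J_iJ_i^T(\mathbf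 J^T\mathbf J)^{-1}\}$, $w_{2,i}=\operatorname{tr}\{K_i(\mathbf J^T\mathbf J)^{-1}\}$. Regularity: $f_i(\theta_0)\neq0$ for all $i$, and there are a ball $B$ around $\theta_0$, a constant $c>0$ and numbers $M_i,N_i$ such that for all $i$ the function $f_i$ is $C^2$ on $B$ and, for all $\theta\in B$, $|f_i(\theta)|\ge c|f_i(\theta_0)|$, $\|\nabla f_i(\theta)\|\le M_i|f_i(\theta_0)|$ and $\|\nabla^2 f_i(\theta)\|\le N_i|f_i(\theta_0)|$, where $\sum_{i\le n}M_i^3=O(n)$ and $\sum_{i\le n}(1+M_i)N_i=O(n)$. Assume that $\mathbf J^T\mathbf J$ is invertible for all large $n$ and that, as $n\to\infty$, $$n^{1/2}\sigma_n\to\delta,\quad (\mathbf J^T\mathbf J/n)^{-1}\to\Sigma,\quad \frac1n\sum_{i=1}^n J_i\to\Gamma_1,\quad \frac1n\sum_{i=1}^n w_{1,i}J_i\to\Gamma_2,\quad \frac1n\sum_{i=1}^n w_{2,i}J_i\to\Gamma_3 .$$ Then for each of the two estimating equations there is a fixed $r>0$ such that, with probability tending to one, the equation has exactly one root in the ball of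 radius $r$ around $\theta_0$; and for every sequence of estimators $\hat\theta_n$ that with probability tending to one lie in this ball and solve the equation (in particular, for every sequence of roots that is consistent for $\theta_0$), $$\frac{\sqrt n(\hat\theta_n-\theta_0)}{\sigma_n}\Rightarrow MVN\bigl(\delta\Sigma(\Gamma_1-\Gamma_2-\tfrac12\Gamma_3),\Sigma\bigr)\quad\text{for WLS},$$ $$\frac{\sqrt n(\hat\theta_n-\theta_0)}{\sigma_n}\Rightarrow MVN\bigl(\delta\Sigma(-2\Gamma_1+2\Gamma_2-\tfrac12\Gamma_3),\Sigma\bigr)\quad\text{for DWLS}.$$ -/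

import Mathlib

open MeasureTheory ProbabilityTheory Filter Topology Asymptotics
open scoped ENNReal

noncomputable section

namespace PropErr

variable {X Ω : Type*} {p : ℕ}

/-- The parameter space `ℝ^p` with the Euclidean norm. -/
abbrev Par (p : ℕ) : Type := EuclideanSpace ℝ (Fin p)

/-- The proportional error responses `y_i = f(x_i, θ₀) (1 + σ ε_i)`. -/
def response (f : X → Par p → ℝ) (x : ℕ → X) (θ₀ : Par p) (σ : ℝ) (e : ℕ → ℝ) (i : ℕ) : ℝ :=
  f (x i) θ₀ * (1 + σ * e i)

/-- Left-hand side of the weighted least squares (WLS) estimating equation at `θ`, for the data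
`(x_i, y_i)` with the `n` indices `i < n`. -/
def wlsScore (f : X → Par p → ℝ) (x : ℕ → X) (y : ℕ → ℝ) (n : ℕ) (θ : Par p) : Par p :=
  (∑ i ∈ Finset.range n, ((y i - f (x i) θ) / f (x i) θ ^ 2) • gradient (f (x i)) θ) +
    ∑ i ∈ Finset.range n, ((y i - f (x i) θ) ^ 2 / f (x i) θ ^ 3) • gradient (f (x i)) θ

/-- Left-hand side of the data weighted least squares (DWLS) estimating equation at `θ`. -/
def dwlsScore (f : X → Par p → ℝ) (x : ℕ → X) (y : ℕ → ℝ) (n : ℕ) (θ : Par p) : Par p :=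
  ∑ i ∈ Finset.range n, ((y i - f (x i) θ) / y i ^ 2) • gradient (f (x i)) θ

/-- `J_i = ∇f(x_i, θ₀) / f(x_i, θ₀)`. -/
def relGrad (f : X → Par p → ℝ) (x : ℕ → X) (θ₀ : Par p) (i : ℕ) : Par p :=
  (f (x i) θ₀)⁻¹ • gradient (f (x i)) θ₀

/-- The Hessian matrix `∂²g / ∂θ_a ∂θ_b`. -/
def hessian (g : Par p → ℝ) (θ : Par p) : Matrix (Fin p) (Fin p) ℝ :=
  Matrix.of fun a b =>
    fderiv ℝ (fderiv ℝ g) θ (EuclideanSpace.single a 1) (EuclideanSpace.single b 1)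

/-- `K_i = H(x_i, θ₀) / f(x_i, θ₀)`, with `H` the Hessian matrix of `f(x_i, ·)`. -/
def relHess (f : X → Par p → ℝ) (x : ℕ → X) (θ₀ : Par p) (i : ℕ) : Matrix (Fin p) (Fin p) ℝ :=
  (f (x i) θ₀)⁻¹ • hessian (f (x i)) θ₀

/-- The `n × p` matrix `J` with rows `J_iᵀ`. -/
def design (f : X → Par p → ℝ) (x : ℕ → X) (θ₀ : Par p) (n : ℕ) : Matrix (Fin n) (Fin p) ℝ :=
  Matrix.of fun i a => relGrad f x θ₀ i a

/-- The Gram matrix `JᵀJ` of the first `n` observations. -/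
def gram (f : X → Par p → ℝ) (x : ℕ → X) (θ₀ : Par p) (n : ℕ) : Matrix (Fin p) (Fin p) ℝ :=
  (design f x θ₀ n).transpose * design f x θ₀ n

/-- `w_{1,i} = tr (J_i J_iᵀ (JᵀJ)⁻¹)`, for sample size `n`. -/
def w₁ (f : X → Par p → ℝ) (x : ℕ → X) (θ₀ : Par p) (n i : ℕ) : ℝ :=
  Matrix.trace (Matrix.vecMulVec (relGrad f x θ₀ i) (relGrad f x θ₀ i) * (gram f x θ₀ n)⁻¹)

/-- `w_{2,i} = tr (K_i (JᵀJ)⁻¹)`, for sample size `n`. -/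
def w₂ (f : X → Par p → ℝ) (x : ℕ → X) (θ₀ : Par p) (n i : ℕ) : ℝ :=
  Matrix.trace (relHess f x θ₀ i * (gram f x θ₀ n)⁻¹)

/-- Regularity of the mean function near `θ₀`: on some ball around `θ₀` the functions `f(x_i, ·)`
are `C²`, do not get small relative to `f(x_i, θ₀) ≠ 0`, and their gradients and Hessians, relative
to `f(x_i, θ₀)`, have envelopes `M_i`, `N_i` with `∑ M_i³ = O(n)` and `∑ (1 + M_i) N_i = O(n)`. -/
def Regular (f : X → Par p → ℝ) (x : ℕ → X) (θ₀ : Par p) : Prop :=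
  (∀ i, f (x i) θ₀ ≠ 0) ∧
  ∃ ρ > (0 : ℝ), ∃ c > (0 : ℝ), ∃ M N : ℕ → ℝ,
    (∀ i, ContDiffOn ℝ 2 (f (x i)) (Metric.ball θ₀ ρ)) ∧
    (∀ i, ∀ θ ∈ Metric.ball θ₀ ρ, c * |f (x i) θ₀| ≤ |f (x i) θ|) ∧
    (∀ i, ∀ θ ∈ Metric.ball θ₀ ρ, ‖gradient (f (x i)) θ‖ ≤ M i * |f (x i) θ₀|) ∧
    (∀ i, ∀ θ ∈ Metric.ball θ₀ ρ, ‖fderiv ℝ (fderiv ℝ (f (x i))) θ‖ ≤ N i * |f (x i) θ₀|) ∧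
    ((fun n : ℕ => ∑ i ∈ Finset.range n, M i ^ 3) =O[atTop] fun n : ℕ => (n : ℝ)) ∧
    ((fun n : ℕ => ∑ i ∈ Finset.range n, (1 + M i) * N i) =O[atTop] fun n : ℕ => (n : ℝ))

/-- `√n (θ̂_n - θ₀) / σ_n ⇒ MVN(m, S)` for the roots `θ̂_n` near `θ₀` of the estimating equations
`Ψ n ω θ = 0`: in some fixed ball around `θ₀` there is, with probability tending to one, exactly
one root, and every sequence of estimators which, with probability tending to one, are roots
in that ball has this limiting distribution. -/
def RootsTendToMVN [MeasurableSpace Ω] (μ : Measure Ω) [IsProbabilityMeasure μ]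
    (Ψ : ℕ → Ω → Par p → Par p) (θ₀ : Par p) (σ : ℕ → ℝ)
    (m : Par p) (S : Matrix (Fin p) (Fin p) ℝ) : Prop :=
  ∃ r > (0 : ℝ),
    Tendsto (fun n => μ {ω | ¬ ∃! θ, θ ∈ Metric.ball θ₀ r ∧ Ψ n ω θ = 0}) atTop (𝓝 0) ∧
    ∀ θhat : ℕ → Ω → Par p, (∀ n, AEMeasurable (θhat n) μ) →
      Tendsto (fun n => μ {ω | ¬ (θhat n ω ∈ Metric.ball θ₀ r ∧ Ψ n ω (θhat n ω) = 0)})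
        atTop (𝓝 0) →
      TendstoInDistribution (fun (n : ℕ) ω => (√(n : ℝ) / σ n) • (θhat n ω - θ₀)) atTop
        (id : Par p → Par p) (fun _ => μ) (multivariateGaussian m S)

end PropErr

end

/-! Divided by `f_i(θ₀)`, both equations take the form `∑ φ(σ ε_i, g_i θ) G_i θ = 0`, where `g_i`
and `G_i` are the mean function and its gradient relative to `f_i(θ₀)` and `φ` is a scalar kernel.
Besides a size bound, only two properties of `φ` matter (`ScoreKernel`): `φ(s, 1) = s + a s² +
O(|s|³)`, with `a = 1` for WLS and `a = -2` for DWLS, and `φ(s, u) - φ(s, v) ≈ -(u - v)` for `s`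
near `0` and `u`, `v` near `1`.

Since `n σ²` converges and `ε` has a second moment, `max_{i<n} |σ ε_i| ≤ η` holds with probability
tending to one for every fixed `η > 0` (`tendsto_measure_exists_gt`). On this event let `F` be the
score divided by `n` and `A = JᵀJ/n`. Then `F θ + A (θ - θ₀)` is Lipschitz on the ball of radius `r`
with constant `O(η + r)` (`LocalModel.score_lip`). For a small fixed `r` the map `θ + A⁻¹ F θ` is a
contraction, which gives exactly one root (`existsUnique_root`), and that root satisfies `θ̂ - θ₀ =
A⁻¹ F θ₀ + O(η ‖F θ₀‖)` (`norm_root_sub_le`).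

After scaling by `√n/σ` the main term is `A⁻¹ n^{-1/2} ∑ ε_i J_i + a √n σ A⁻¹ n⁻¹ ∑ ε_i² J_i`. The
first part is asymptotically normal with covariance `lim A⁻¹ = Σ`
(`tendstoInDistribution_sum_smul_add`); the second tends in probability to `a δ Σ Γ₁` by a weighted
weak law (`tendstoInMeasure_weighted_mean`).

The terms with `Γ₂` and `Γ₃` vanish: `(JᵀJ)⁻¹ = O(1/n)`, so `w_{1,i} = O(M_i²/n)` and `w_{2,i} =
O(N_i/n)`, and the envelope conditions force `Γ₂ = Γ₃ = 0` (`tendsto_weighted_trace_zero`). Both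
asserted means therefore equal `a δ Σ Γ₁`. -/

namespace PropErr

/-! ### Characteristic functions of weighted i.i.d. sums -/

section CLT

/-- Exchanging the factors one at a time costs `‖a i - b i‖` each, because all remaining factors
have norm at most one. -/
theorem norm_prod_sub_prod_le {ι : Type*} (s : Finset ι) (a b : ι → ℂ) (ha : ∀ i ∈ s, ‖a i‖ ≤ 1)
    (hb : ∀ i ∈ s, ‖b i‖ ≤ 1) : ‖∏ i ∈ s, a i - ∏ i ∈ s, b i‖ ≤ ∑ i ∈ s, ‖a i - b i‖ := by
  classical
  induction s using Finset.induction_on with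
  | empty => simp
  | insert j s hj ih =>
    rw [Finset.prod_insert hj, Finset.prod_insert hj, Finset.sum_insert hj]
    have h1 : ‖∏ i ∈ s, b i‖ ≤ 1 := by
      rw [norm_prod]
      exact Finset.prod_le_one (fun _ _ => norm_nonneg _)
        fun i hi => hb i (Finset.mem_insert_of_mem hi)
    have h2 := ih (fun i hi => ha i (Finset.mem_insert_of_mem hi))
      (fun i hi => hb i (Finset.mem_insert_of_mem hi))
    have h3 := ha j (Finset.mem_insert_self _ _)
    calc ‖a j * ∏ i ∈ s, a i - b j * ∏ i ∈ s, b i‖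
        = ‖a j * (∏ i ∈ s, a i - ∏ i ∈ s, b i) + (a j - b j) * ∏ i ∈ s, b i‖ := by ring_nf
      _ ≤ ‖a j‖ * ‖∏ i ∈ s, a i - ∏ i ∈ s, b i‖ + ‖a j - b j‖ * ‖∏ i ∈ s, b i‖ := by
          rw [← norm_mul, ← norm_mul]; exact norm_add_le _ _
      _ ≤ 1 * (∑ i ∈ s, ‖a i - b i‖) + ‖a j - b j‖ * 1 := by gcongr
      _ = _ := by ring

variable {Ω : Type*} [MeasurableSpace Ω] {μ : Measure Ω}

/-- Both functions have the second-order Taylor polynomial `1 - t²/2` at `0`; a second moment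
suffices for this. -/
theorem charFun_sub_gaussian_isLittleO [IsProbabilityMeasure μ] {X : Ω → ℝ} (hX : AEMeasurable X μ)
    (h0 : ∫ ω, X ω ∂μ = 0) (h1 : ∫ ω, X ω ^ 2 ∂μ = 1) :
    (fun t : ℝ => charFun (μ.map X) t - Complex.exp (-(t : ℂ) ^ 2 / 2))
      =o[𝓝 0] fun t : ℝ => t ^ 2 := by
  have hA := taylor_charFun_two (P := μ) hX h0 h1
  have hB : (fun t : ℝ => Complex.exp (-(t : ℂ) ^ 2 / 2) - (1 - (t : ℂ) ^ 2 / 2))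
      =o[𝓝 0] fun t : ℝ => t ^ 2 := by
    have hO : (fun t : ℝ => Complex.exp (-(t : ℂ) ^ 2 / 2) - (1 - (t : ℂ) ^ 2 / 2))
        =O[𝓝 0] fun t : ℝ => t ^ 4 := by
      refine IsBigO.of_bound 1 ?_
      filter_upwards [Metric.ball_mem_nhds (0 : ℝ) one_pos] with t ht
      have ht1 : |t| ≤ 1 := by simpa using (Metric.mem_ball.1 ht).le
      have hn : ‖-(t : ℂ) ^ 2 / 2‖ = |t| ^ 2 / 2 := by simp
      have hsq : |t| ^ 2 ≤ 1 := pow_le_one₀ (abs_nonneg _) ht1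
      have := Complex.norm_exp_sub_one_sub_id_le (x := -(t : ℂ) ^ 2 / 2) (by rw [hn]; linarith)
      rw [hn] at this
      calc _ = ‖Complex.exp (-(t : ℂ) ^ 2 / 2) - 1 - -(t : ℂ) ^ 2 / 2‖ := by ring_nf
        _ ≤ _ := this
        _ ≤ _ := by
          rw [norm_pow, Real.norm_eq_abs]
          nlinarith [pow_nonneg (abs_nonneg t) 4]
    exact hO.trans_isLittleO (isLittleO_pow_pow (by norm_num : 2 < 4))
  simpa using hA.sub hB

/-- A Lindeberg-type limit for the characteristic functions of weighted sums. -/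
theorem tendsto_prod_charFun [IsProbabilityMeasure μ] {X : Ω → ℝ} (hX : AEMeasurable X μ)
    (h0 : ∫ ω, X ω ∂μ = 0) (h1 : ∫ ω, X ω ^ 2 ∂μ = 1) {b : ℕ → ℕ → ℝ} {v : ℝ}
    (hsq : Tendsto (fun n => ∑ i ∈ Finset.range n, b n i ^ 2) atTop (𝓝 v))
    (hmax : ∀ η > 0, ∀ᶠ n in atTop, ∀ i < n, |b n i| ≤ η) :
    Tendsto (fun n => ∏ i ∈ Finset.range n, charFun (μ.map X) (b n i)) atTop
      (𝓝 (Complex.exp (-(v : ℂ) / 2))) := by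
  have : IsProbabilityMeasure (μ.map X) := Measure.isProbabilityMeasure_map hX
  have hg : Tendsto (fun n => ∏ i ∈ Finset.range n, Complex.exp (-(b n i : ℂ) ^ 2 / 2)) atTop
      (𝓝 (Complex.exp (-(v : ℂ) / 2))) := by
    have : ∀ n, ∏ i ∈ Finset.range n, Complex.exp (-(b n i : ℂ) ^ 2 / 2) =
        Complex.exp (-((∑ i ∈ Finset.range n, b n i ^ 2 : ℝ) : ℂ) / 2) := by
      intro n
      rw [← Complex.exp_sum]
      push_cast
      rw [← Finset.sum_neg_distrib, Finset.sum_div]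
    simp_rw [this]
    exact (Complex.continuous_exp.tendsto _).comp
      (((Complex.continuous_ofReal.tendsto _).comp hsq).neg.div_const 2)
  suffices h : Tendsto (fun n => ∏ i ∈ Finset.range n, charFun (μ.map X) (b n i) -
      ∏ i ∈ Finset.range n, Complex.exp (-(b n i : ℂ) ^ 2 / 2)) atTop (𝓝 0) by
    simpa using h.add hg
  rw [Metric.tendsto_nhds]
  intro τ hτ
  have hv1 : ∀ᶠ n in atTop, ∑ i ∈ Finset.range n, b n i ^ 2 < |v| + 1 :=
    hsq.eventually_lt_const (by linarith [le_abs_self v])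
  -- With this relative error per factor, the telescoped sum is at most `τ / 2`, since `∑ b²` is
  -- eventually below `|v| + 1`.
  have hc : 0 < τ / (|v| + 1) / 2 := by positivity
  have ho := (isLittleO_iff.1 (charFun_sub_gaussian_isLittleO hX h0 h1)) hc
  obtain ⟨η, hη, hball⟩ := Metric.eventually_nhds_iff.1 ho
  filter_upwards [hv1, hmax (η / 2) (by positivity)] with n hn hb
  rw [dist_zero_right]
  refine (norm_prod_sub_prod_le (Finset.range n) _ _
    (fun i _ => norm_charFun_le_one _) fun i _ => ?_).trans_lt ?_
  · rw [Complex.norm_exp]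
    have : (-(b n i : ℂ) ^ 2 / 2).re = -(b n i ^ 2) / 2 := by
      rw [← Complex.ofReal_pow, ← Complex.ofReal_neg, ← Complex.ofReal_ofNat, ← Complex.ofReal_div,
        Complex.ofReal_re]
    rw [this, Real.exp_le_one_iff]
    nlinarith [sq_nonneg (b n i)]
  · calc ∑ i ∈ Finset.range n, ‖charFun (μ.map X) (b n i) - Complex.exp (-(b n i : ℂ) ^ 2 / 2)‖
        ≤ ∑ i ∈ Finset.range n, τ / (|v| + 1) / 2 * b n i ^ 2 := by
          refine Finset.sum_le_sum fun i hi => ?_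
          have := @hball (b n i) (by
            rw [Real.dist_eq, sub_zero]
            exact (hb i (Finset.mem_range.1 hi)).trans_lt (by linarith))
          simpa using this
      _ = τ / (|v| + 1) / 2 * ∑ i ∈ Finset.range n, b n i ^ 2 := by rw [Finset.mul_sum]
      _ ≤ τ / (|v| + 1) / 2 * (|v| + 1) := by gcongr
      _ = τ / 2 := by field_simp
      _ < τ := by linarith

theorem charFun_map_sum_smul {E : Type*} [NormedAddCommGroup E] [InnerProductSpace ℝ E]
    [MeasurableSpace E] [BorelSpace E] [SecondCountableTopology E]
    {ε : ℕ → Ω → ℝ} (hm : ∀ i, Measurable (ε i))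
    (hi : iIndepFun ε μ) (hid : ∀ i, IdentDistrib (ε i) (ε 0) μ μ) (n : ℕ) (u : ℕ → E) (t : E) :
    charFun (μ.map fun ω => ∑ i ∈ Finset.range n, ε i ω • u i) t =
      ∏ i ∈ Finset.range n, charFun (μ.map (ε 0)) (inner ℝ (u i) t) := by
  have hmi : ∀ i, Measurable fun ω => ε i ω • u i := fun i => (hm i).smul_const _
  have hc : iIndepFun (fun i ω => ε i ω • u i) μ :=
    hi.comp (fun i r => r • u i) fun i => measurable_id.smul_const _
  rw [iIndepFun.charFun_map_fun_finsetSum_eq_prod (fun i _ => (hmi i).aemeasurable) (hc.restrict _),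
    Finset.prod_apply]
  refine Finset.prod_congr rfl fun i _ => ?_
  rw [← (hid i).map_eq, charFun_apply, charFun_apply,
    integral_map (hmi i).aemeasurable (by fun_prop), integral_map (hm i).aemeasurable (by fun_prop)]
  simp [real_inner_smul_left, mul_comm]

end CLT

/-! ### Second moments, maximal noise, and a weighted weak law -/

section Moments

variable {Ω : Type*} [MeasurableSpace Ω] {μ : Measure Ω}
  {E : Type*} [NormedAddCommGroup E] [InnerProductSpace ℝ E]

theorem norm_sum_smul_sq (n : ℕ) (a : ℕ → ℝ) (u : ℕ → E) :
    ‖∑ i ∈ Finset.range n, a i • u i‖ ^ 2 =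
      ∑ i ∈ Finset.range n, ∑ j ∈ Finset.range n, a i * a j * inner ℝ (u i) (u j) := by
  rw [← real_inner_self_eq_norm_sq, sum_inner]
  refine Finset.sum_congr rfl fun i _ => ?_
  rw [inner_sum]
  refine Finset.sum_congr rfl fun j _ => ?_
  rw [real_inner_smul_left, real_inner_smul_right]
  ring

theorem integral_norm_sum_smul_sq {W : ℕ → Ω → ℝ} (hL : ∀ i, MemLp (W i) 2 μ)
    (hi : iIndepFun W μ) (h0 : ∀ i, ∫ ω, W i ω ∂μ = 0) {τ : ℝ} (hτ : ∀ i, ∫ ω, W i ω ^ 2 ∂μ = τ)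
    (n : ℕ) (u : ℕ → E) :
    Integrable (fun ω => ‖∑ i ∈ Finset.range n, W i ω • u i‖ ^ 2) μ ∧
    ∫ ω, ‖∑ i ∈ Finset.range n, W i ω • u i‖ ^ 2 ∂μ = τ * ∑ i ∈ Finset.range n, ‖u i‖ ^ 2 := by
  have hint : ∀ i j, Integrable (fun ω => W i ω * W j ω * inner ℝ (u i) (u j)) μ :=
    fun i j => ((hL i).integrable_mul (hL j)).mul_const _
  simp_rw [norm_sum_smul_sq]
  refine ⟨integrable_finsetSum _ fun i _ => integrable_finsetSum _ fun j _ => hint i j, ?_⟩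
  rw [integral_finsetSum _ fun i _ => integrable_finsetSum _ fun j _ => hint i j, Finset.mul_sum]
  refine Finset.sum_congr rfl fun i hi' => ?_
  rw [integral_finsetSum _ fun j _ => hint i j, Finset.sum_eq_single i]
  · rw [integral_mul_const, real_inner_self_eq_norm_sq, ← hτ i]
    simp_rw [sq]
  · intro j _ hj
    rw [integral_mul_const, (hi.indepFun hj.symm).integral_fun_mul_eq_mul_integral
      (hL i).aestronglyMeasurable (hL j).aestronglyMeasurable, h0 i]
    simp
  · intro h; exact absurd hi' h

/-- A union bound combined with a truncated Chebyshev inequality gives `n σ² η⁻² E[ε²; |σ ε| > η]`.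
The factor `n σ²` converges to `δ²`, and the truncated moment tends to zero by dominated convergence
because `σ → 0`. -/
theorem tendsto_measure_exists_gt [IsProbabilityMeasure μ] {ε : ℕ → Ω → ℝ} (hm : ∀ i, Measurable (ε i))
    (hid : ∀ i, IdentDistrib (ε i) (ε 0) μ μ) (hL2 : MemLp (ε 0) 2 μ)
    {σ : ℕ → ℝ} {δ : ℝ}
    (hδ : Tendsto (fun n : ℕ => √(n : ℝ) * σ n) atTop (𝓝 δ)) {η : ℝ} (hη : 0 < η) :
    Tendsto (fun n => μ.real {ω | ¬ ∀ i < n, |σ n * ε i ω| ≤ η}) atTop (𝓝 0) := by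
  have hsq : Tendsto (fun n : ℕ => (n : ℝ) * σ n ^ 2) atTop (𝓝 (δ ^ 2)) := by
    refine (hδ.pow 2).congr fun n => ?_
    rw [mul_pow, Real.sq_sqrt (Nat.cast_nonneg n)]
  have hσ0 : Tendsto σ atTop (𝓝 0) := by
    have h1 : Tendsto (fun n : ℕ => (√(n : ℝ))⁻¹) atTop (𝓝 0) :=
      tendsto_inv_atTop_zero.comp (Real.tendsto_sqrt_atTop.comp tendsto_natCast_atTop_atTop)
    have := hδ.mul h1
    rw [mul_zero] at this
    refine this.congr' ?_
    filter_upwards [eventually_gt_atTop 0] with n hn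
    have : 0 < √(n : ℝ) := Real.sqrt_pos.2 (by exact_mod_cast hn)
    field_simp
  have hI : Integrable (fun ω => ε 0 ω ^ 2) μ := hL2.integrable_sq
  have hms : ∀ n, MeasurableSet {ω | η < |σ n * ε 0 ω|} := fun n =>
    measurableSet_lt measurable_const ((hm 0).const_mul _).abs
  have htail : Tendsto (fun n => ∫ ω, {ω | η < |σ n * ε 0 ω|}.indicator (fun ω => ε 0 ω ^ 2) ω ∂μ)
      atTop (𝓝 0) := by
    have := tendsto_integral_of_dominated_convergence (μ := μ)
      (F := fun n => {ω | η < |σ n * ε 0 ω|}.indicator (fun ω => ε 0 ω ^ 2)) (f := fun _ => 0)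
      (fun ω => ε 0 ω ^ 2)
      (fun n => hI.aestronglyMeasurable.indicator (hms n)) hI
      (fun n => ae_of_all _ fun ω => by
        refine (norm_indicator_le_norm_self _ _).trans_eq ?_
        simp)
      (ae_of_all _ fun ω => ?_)
    · simpa using this
    · have h0 : Tendsto (fun n => |σ n * ε 0 ω|) atTop (𝓝 0) := by
        simpa using (hσ0.mul_const (ε 0 ω)).abs
      refine tendsto_const_nhds.congr' ?_
      filter_upwards [h0.eventually_lt_const hη] with n hn
      rw [Set.indicator_of_notMem]
      simpa using hn.le
  have hbound : ∀ n, μ.real {ω | ¬ ∀ i < n, |σ n * ε i ω| ≤ η} ≤ (n * σ n ^ 2) * (η ^ 2)⁻¹ *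
      ∫ ω, {ω | η < |σ n * ε 0 ω|}.indicator (fun ω => ε 0 ω ^ 2) ω ∂μ := by
    intro n
    have hsub : {ω | ¬ ∀ i < n, |σ n * ε i ω| ≤ η} ⊆
        ⋃ i ∈ Finset.range n, {ω | η < |σ n * ε i ω|} := by
      intro ω hω
      simp only [Set.mem_ofPred_eq, not_forall, not_le] at hω
      obtain ⟨i, hi, h⟩ := hω
      simp only [Set.mem_iUnion, Finset.mem_range]
      exact ⟨i, hi, h⟩
    have hone : ∀ i, μ.real {ω | η < |σ n * ε i ω|} ≤ σ n ^ 2 * (η ^ 2)⁻¹ *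
        ∫ ω, {ω | η < |σ n * ε 0 ω|}.indicator (fun ω => ε 0 ω ^ 2) ω ∂μ := by
      intro i
      have he : μ.real {ω | η < |σ n * ε i ω|} = μ.real {ω | η < |σ n * ε 0 ω|} := by
        have := (hid i).measure_mem_eq (s := {r : ℝ | η < |σ n * r|})
          (measurableSet_lt measurable_const (measurable_id.const_mul _).abs)
        exact congrArg ENNReal.toReal this
      rw [he, ← integral_const_mul, ← integral_indicator_one (hms n)]
      refine integral_mono ((integrable_const 1).indicator (hms n))
        ((hI.indicator (hms n)).const_mul _) fun ω => ?_
      by_cases hω : η < |σ n * ε 0 ω|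
      · simp only [Set.indicator, Set.mem_ofPred_eq, hω, if_true, Pi.one_apply]
        have : η ^ 2 ≤ σ n ^ 2 * ε 0 ω ^ 2 := by
          rw [← mul_pow, ← sq_abs (σ n * ε 0 ω)]
          gcongr
        calc (1 : ℝ) = (η ^ 2)⁻¹ * η ^ 2 := by field_simp
          _ ≤ (η ^ 2)⁻¹ * (σ n ^ 2 * ε 0 ω ^ 2) := by gcongr
          _ = _ := by ring
      · rw [Set.indicator_of_notMem (by exact hω), Set.indicator_of_notMem (by exact hω), mul_zero]
    calc _ ≤ μ.real (⋃ i ∈ Finset.range n, {ω | η < |σ n * ε i ω|}) :=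
          measureReal_mono hsub (measure_ne_top _ _)
      _ ≤ ∑ i ∈ Finset.range n, μ.real {ω | η < |σ n * ε i ω|} :=
        measureReal_biUnion_finset_le _ _
      _ ≤ ∑ i ∈ Finset.range n, _ := Finset.sum_le_sum fun i _ => hone i
      _ = _ := by
        rw [Finset.sum_const, Finset.card_range, nsmul_eq_mul]
        ring
  refine squeeze_zero (fun n => measureReal_nonneg) hbound ?_
  simpa using (hsq.mul_const ((η ^ 2)⁻¹)).mul htail

/-- Markov's inequality for `R` outside the exceptional sets. These sets may depend on the accuracy
`η`, which later allows the noise threshold to be chosen after the accuracy. -/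
theorem tendstoInMeasure_zero_of_bound [IsFiniteMeasure μ] {F : Type*} [SeminormedAddCommGroup F]
    {Z : ℕ → Ω → F}
    (h : ∀ η > 0, ∃ Bad : ℕ → Set Ω, Tendsto (fun n => μ.real (Bad n)) atTop (𝓝 0) ∧
      ∀ᶠ n in atTop, ∃ R : Ω → ℝ, Integrable R μ ∧ 0 ≤ R ∧ ∫ ω, R ω ∂μ ≤ η ∧
        ∀ ω ∉ Bad n, ‖Z n ω‖ ≤ R ω) :
    TendstoInMeasure μ Z atTop 0 := by
  rw [tendstoInMeasure_iff_measureReal_norm]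
  intro τ hτ
  rw [Metric.tendsto_nhds]
  intro κ hκ
  obtain ⟨Bad, hBad, hR⟩ := h (τ * κ / 2) (by positivity)
  filter_upwards [hBad.eventually_lt_const (half_pos hκ), hR] with n hn ⟨R, hRi, hR0, hRη, hZR⟩
  rw [Real.dist_eq, sub_zero, abs_of_nonneg measureReal_nonneg]
  have hsub : {ω | τ ≤ ‖Z n ω - (0 : Ω → F) ω‖} ⊆ Bad n ∪ {ω | τ ≤ R ω} := by
    intro ω hω
    by_cases hb : ω ∈ Bad n
    · exact Or.inl hb
    · refine Or.inr (le_trans ?_ (hZR ω hb))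
      simpa using hω
  have hM := mul_meas_ge_le_integral_of_nonneg (ae_of_all _ hR0) hRi τ
  have h2 : μ.real {ω | τ ≤ R ω} ≤ κ / 2 := by
    refine le_of_mul_le_mul_left ?_ hτ
    linarith
  calc _ ≤ μ.real (Bad n ∪ {ω | τ ≤ R ω}) := measureReal_mono hsub (measure_ne_top _ _)
    _ ≤ μ.real (Bad n) + μ.real {ω | τ ≤ R ω} := measureReal_union_le _ _
    _ < κ := by linarith

theorem TendstoInMeasure.add_zero [IsFiniteMeasure μ] {F : Type*} [SeminormedAddCommGroup F]
    {Y Z : ℕ → Ω → F} (hY : TendstoInMeasure μ Y atTop 0) (hZ : TendstoInMeasure μ Z atTop 0) :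
    TendstoInMeasure μ (Y + Z) atTop 0 := by
  rw [tendstoInMeasure_iff_measureReal_norm] at *
  intro τ hτ
  have h := (hY (τ / 2) (half_pos hτ)).add (hZ (τ / 2) (half_pos hτ))
  rw [_root_.add_zero] at h
  refine squeeze_zero (fun n => measureReal_nonneg) (fun n => ?_) h
  refine (measureReal_mono ?_ (measure_ne_top _ _)).trans (measureReal_union_le _ _)
  intro ω hω
  simp only [Set.mem_ofPred_eq, Pi.add_apply, Pi.zero_apply, sub_zero, Set.mem_union] at hω ⊢
  by_contra! hcon
  linarith [norm_add_le (Y n ω) (Z n ω)]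

/-- A weighted weak law of large numbers for nonnegative integrable variables. -/
theorem tendstoInMeasure_weighted_mean [IsProbabilityMeasure μ] {W : ℕ → Ω → ℝ}
    (hm : ∀ i, Measurable (W i))
    (hi : iIndepFun W μ) (hid : ∀ i, IdentDistrib (W i) (W 0) μ μ) (hI : Integrable (W 0) μ)
    (hpos : ∀ i ω, 0 ≤ W i ω) {u : ℕ → E} {C : ℝ}
    (hu1 : ∀ᶠ n : ℕ in atTop, ∑ i ∈ Finset.range n, ‖u i‖ ≤ C * n)
    (hu2 : ∀ᶠ n : ℕ in atTop, ∑ i ∈ Finset.range n, ‖u i‖ ^ 2 ≤ C * n) :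
    TendstoInMeasure μ
      (fun (n : ℕ) ω => (n : ℝ)⁻¹ • ∑ i ∈ Finset.range n, (W i ω - ∫ ω, W 0 ω ∂μ) • u i) atTop 0 := by
  have hC : 0 ≤ C := by
    obtain ⟨n, hn, hn0⟩ := (hu1.and (eventually_gt_atTop 0)).exists
    have : 0 ≤ C * n := (Finset.sum_nonneg fun _ _ => norm_nonneg _).trans hn
    exact nonneg_of_mul_nonneg_left this (by exact_mod_cast hn0)
  have hIi : ∀ i, Integrable (W i) μ := fun i => (hid i).integrable_iff.2 hI
  set m := ∫ ω, W 0 ω ∂μ with hmdef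
  refine tendstoInMeasure_zero_of_bound fun η hη => ⟨fun _ => ∅, by simp, ?_⟩
  -- Only a first moment is available, so `W` is truncated. The level makes the loss of mean so
  -- small that the tail contributes at most `η / 3`.
  have hA : ∀ᶠ A : ℝ in atTop, m - η / 3 / (2 * (C + 1)) < ∫ ω, truncation (W 0) A ω ∂μ :=
    (tendsto_integral_truncation hI).eventually_const_lt (by
      have : 0 < η / 3 / (2 * (C + 1)) := by positivity
      linarith)
  obtain ⟨A, hA⟩ := hA.exists
  set mA := ∫ ω, truncation (W 0) A ω ∂μ with hmA
  set T : ℕ → Ω → ℝ := fun i ω => truncation (W i) A ω - mA with hT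
  have hTm : ∀ i, MemLp (truncation (W i) A) 2 μ := fun i =>
    (hm i).aestronglyMeasurable.memLp_truncation
  have hTL : ∀ i, MemLp (T i) 2 μ := fun i => (hTm i).sub (memLp_const mA)
  have hidT : ∀ i, IdentDistrib (truncation (W i) A) (truncation (W 0) A) μ μ :=
    fun i => (hid i).truncation
  have hintT : ∀ i, ∫ ω, truncation (W i) A ω ∂μ = mA := fun i => (hidT i).integral_eq
  have hTi : ∀ i, Integrable (truncation (W i) A) μ := fun i => (hTm i).integrable (by norm_num)
  have hT0 : ∀ i, ∫ ω, T i ω ∂μ = 0 := fun i => by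
    simp only [hT]
    rw [integral_sub (hTi i) (integrable_const _), hintT]
    simp
  have hTV : ∀ i, ∫ ω, T i ω ^ 2 ∂μ = ∫ ω, T 0 ω ^ 2 ∂μ := fun i =>
    ((hidT i).comp (u := fun r => (r - mA) ^ 2) (by fun_prop)).integral_eq
  have hTindep : iIndepFun T μ :=
    hi.comp (fun _ r => (Set.indicator (Set.Ioc (-A) A) id r : ℝ) - mA)
      fun _ => (measurable_id.indicator measurableSet_Ioc).sub_const _
  set V := ∫ ω, T 0 ω ^ 2 ∂μ with hV
  have hV0 : 0 ≤ V := integral_nonneg fun _ => sq_nonneg _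
  have hnorm := fun n : ℕ => integral_norm_sum_smul_sq hTL hTindep hT0 hTV n u
  -- The centred tail is `D i - 2 (m - mA)`. Adding the constant `m - mA` to the nonnegative tail
  -- makes `D i` dominate its absolute value, while the mean of `D i` is still only `2 (m - mA)`.
  set D : ℕ → Ω → ℝ := fun i ω => (W i ω - truncation (W i) A ω) + (m - mA) with hD
  have htr : ∀ i ω, truncation (W i) A ω ≤ W i ω := fun i ω =>
    (le_abs_self _).trans ((abs_truncation_le_abs_self _ _ _).trans (abs_of_nonneg (hpos i ω)).le)
  have hmmA : mA ≤ m := integral_mono (hTi 0) hI fun ω => htr 0 ω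
  have hDI : ∀ i, Integrable (D i) μ := fun i => ((hIi i).sub (hTi i)).add (integrable_const _)
  have hD0 : ∀ i ω, 0 ≤ D i ω := fun i ω => by
    simp only [hD]; linarith [htr i ω]
  have hDint : ∀ i, ∫ ω, D i ω ∂μ = 2 * (m - mA) := fun i => by
    simp only [hD]
    have hsub : Integrable (fun ω => W i ω - truncation (W i) A ω) μ := (hIi i).sub (hTi i)
    rw [integral_add hsub (integrable_const _), integral_sub (hIi i) (hTi i),
      hintT, (hid i).integral_eq]
    simp
    ring
  have hlim : Tendsto (fun n : ℕ => (η / 3)⁻¹ * (V * C) * (n : ℝ)⁻¹) atTop (𝓝 0) := by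
    simpa using tendsto_inv_atTop_nhds_zero_nat (𝕜 := ℝ) |>.const_mul ((η / 3)⁻¹ * (V * C))
  filter_upwards [hu1, hu2, eventually_gt_atTop 0, hlim.eventually_lt_const (by positivity : 0 < η / 3)]
    with n h1 h2 hn h3
  have hn' : (0 : ℝ) < n := by exact_mod_cast hn
  have hI1 : Integrable (fun ω => (n : ℝ)⁻¹ * ∑ i ∈ Finset.range n, D i ω * ‖u i‖) μ :=
    (integrable_finsetSum _ fun i _ => (hDI i).mul_const _).const_mul _
  have hI2 : Integrable (fun ω => (η / 3)⁻¹ * ((n : ℝ)⁻¹ ^ 2 *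
      ‖∑ i ∈ Finset.range n, T i ω • u i‖ ^ 2)) μ := ((hnorm n).1.const_mul _).const_mul _
  have hI3 : Integrable (fun ω => η / 3 + (η / 3)⁻¹ * ((n : ℝ)⁻¹ ^ 2 *
      ‖∑ i ∈ Finset.range n, T i ω • u i‖ ^ 2)) μ := (integrable_const _).add hI2
  refine ⟨fun ω => (n : ℝ)⁻¹ * ∑ i ∈ Finset.range n, D i ω * ‖u i‖ + (η / 3 +
      (η / 3)⁻¹ * ((n : ℝ)⁻¹ ^ 2 * ‖∑ i ∈ Finset.range n, T i ω • u i‖ ^ 2)), ?_, ?_, ?_, ?_⟩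
  · exact hI1.add hI3
  · intro ω
    have := Finset.sum_nonneg fun i (_ : i ∈ Finset.range n) =>
      mul_nonneg (hD0 i ω) (norm_nonneg (u i))
    simp only [Pi.zero_apply]
    positivity
  · rw [integral_add hI1 hI3, integral_add (integrable_const _) hI2,
      integral_const_mul, integral_const_mul, integral_const_mul, (hnorm n).2,
      integral_finsetSum _ fun i _ => (hDI i).mul_const _]
    simp_rw [integral_mul_const, hDint, ← Finset.mul_sum]
    have e1 : (n : ℝ)⁻¹ * (2 * (m - mA) * ∑ i ∈ Finset.range n, ‖u i‖) ≤ η / 3 := by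
      calc _ ≤ (n : ℝ)⁻¹ * (2 * (m - mA) * (C * n)) := by
            have : 0 ≤ m - mA := by linarith
            gcongr
        _ = 2 * (m - mA) * C := by field_simp
        _ ≤ 2 * (η / 3 / (2 * (C + 1))) * (C + 1) := by
            have : m - mA ≤ η / 3 / (2 * (C + 1)) := by linarith
            have h0 : 0 ≤ m - mA := by linarith
            gcongr
            linarith
        _ = η / 3 := by field_simp
    have e2 : (η / 3)⁻¹ * ((n : ℝ)⁻¹ ^ 2 * (V * ∑ i ∈ Finset.range n, ‖u i‖ ^ 2)) ≤ η / 3 := by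
      calc _ ≤ (η / 3)⁻¹ * ((n : ℝ)⁻¹ ^ 2 * (V * (C * n))) := by gcongr
        _ = (η / 3)⁻¹ * (V * C) * (n : ℝ)⁻¹ := by field_simp
        _ ≤ _ := h3.le
    simp only [integral_const, probReal_univ, smul_eq_mul, one_mul]
    linarith
  · intro ω _
    have hsplit : ∑ i ∈ Finset.range n, (W i ω - m) • u i =
        ∑ i ∈ Finset.range n, (D i ω - 2 * (m - mA)) • u i + ∑ i ∈ Finset.range n, T i ω • u i := by
      rw [← Finset.sum_add_distrib]
      refine Finset.sum_congr rfl fun i _ => ?_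
      rw [← add_smul]
      congr 1
      simp only [hD, hT]
      ring
    have hDabs : ∀ i, |D i ω - 2 * (m - mA)| ≤ D i ω := fun i => by
      rw [abs_le]
      simp only [hD]
      constructor <;> linarith [htr i ω]
    rw [hsplit, smul_add]
    refine (norm_add_le _ _).trans (add_le_add ?_ ?_)
    · rw [norm_smul, Real.norm_eq_abs, abs_of_pos (inv_pos.2 hn')]
      gcongr
      refine (norm_sum_le _ _).trans (Finset.sum_le_sum fun i _ => ?_)
      rw [norm_smul, Real.norm_eq_abs]
      gcongr
      exact hDabs i
    · rw [norm_smul, Real.norm_eq_abs, abs_of_pos (inv_pos.2 hn')]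
      rw [← mul_pow]
      set a := (n : ℝ)⁻¹ * ‖∑ i ∈ Finset.range n, T i ω • u i‖
      have hη3 : 0 < η / 3 := by positivity
      generalize η / 3 = γ at hη3
      -- The inequality `2 a ≤ γ + γ⁻¹ a²` replaces the norm of the truncated sum by its square,
      -- whose integral is explicit.
      have : 0 ≤ γ⁻¹ * (a - γ) ^ 2 := by positivity
      have e : γ⁻¹ * (a - γ) ^ 2 = γ + γ⁻¹ * a ^ 2 - 2 * a := by field_simp; ring
      have ha : 0 ≤ a := by positivity
      linarith

end Moments

/-! ### Roots of perturbed linear maps -/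

section Root

variable {E : Type*} [NormedAddCommGroup E] [NormedSpace ℝ E]

theorem norm_sub_sub_le_of_lipschitz {F : E → E} {A T : E →L[ℝ] E} (hTA : ∀ v, T (A v) = v)
    {L κ : ℝ} (hT : ‖T‖ ≤ L) {θ θ' : E} (h : ‖F θ - F θ' + A (θ - θ')‖ ≤ κ * ‖θ - θ'‖) :
    ‖T (F θ - F θ') + (θ - θ')‖ ≤ L * κ * ‖θ - θ'‖ := by
  have hL : 0 ≤ L := (norm_nonneg T).trans hT
  calc _ = ‖T (F θ - F θ' + A (θ - θ'))‖ := by rw [map_add T, hTA]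
    _ ≤ ‖T‖ * ‖F θ - F θ' + A (θ - θ')‖ := T.le_opNorm _
    _ ≤ L * (κ * ‖θ - θ'‖) := by gcongr
    _ = _ := by ring

/-- A perturbation `F` of `-A` has exactly one zero in a ball if `F` is small at the centre. -/
theorem existsUnique_root [CompleteSpace E] {F : E → E} {A T : E →L[ℝ] E}
    (hTA : ∀ v, T (A v) = v) (hAT : ∀ v, A (T v) = v) {L κ r : ℝ} (hT : ‖T‖ ≤ L) {θ₀ : E}
    (hr : 0 < r) (hF : ∀ θ ∈ Metric.closedBall θ₀ r, ∀ θ' ∈ Metric.closedBall θ₀ r,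
      ‖F θ - F θ' + A (θ - θ')‖ ≤ κ * ‖θ - θ'‖)
    (hκ : L * κ ≤ 1 / 2) (h0 : L * ‖F θ₀‖ ≤ r / 4) :
    ∃! θ, θ ∈ Metric.ball θ₀ r ∧ F θ = 0 := by
  have hL : 0 ≤ L := (norm_nonneg T).trans hT
  -- A Newton step with the frozen derivative `-A`; since `T` is the inverse of `A`, the fixed
  -- points of `Φ` are exactly the zeros of `F`.
  set Φ : E → E := fun θ => θ + T (F θ) with hΦ
  have hlip : ∀ θ ∈ Metric.closedBall θ₀ r, ∀ θ' ∈ Metric.closedBall θ₀ r,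
      ‖Φ θ - Φ θ'‖ ≤ 1 / 2 * ‖θ - θ'‖ := by
    intro θ hθ θ' hθ'
    have := norm_sub_sub_le_of_lipschitz hTA hT (hF θ hθ θ' hθ')
    have e : Φ θ - Φ θ' = T (F θ - F θ') + (θ - θ') := by
      simp only [hΦ, map_sub]; abel
    rw [e]
    exact this.trans (by gcongr)
  have hsub : Metric.closedBall θ₀ (r / 2) ⊆ Metric.closedBall θ₀ r :=
    Metric.closedBall_subset_closedBall (by linarith)
  have hc : θ₀ ∈ Metric.closedBall θ₀ r := Metric.mem_closedBall_self hr.le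
  -- The centre moves by at most `r / 4` and the contraction adds at most `r / 4`. Working on the
  -- half ball keeps the root inside the open ball, whereas uniqueness uses the contraction on the
  -- whole ball.
  have hmaps : Set.MapsTo Φ (Metric.closedBall θ₀ (r / 2)) (Metric.closedBall θ₀ (r / 2)) := by
    intro θ hθ
    have h1 := hlip θ (hsub hθ) θ₀ hc
    rw [mem_closedBall_iff_norm] at hθ ⊢
    have h2 : ‖Φ θ₀ - θ₀‖ ≤ r / 4 := by
      simp only [hΦ, add_sub_cancel_left]
      exact ((T.le_opNorm _).trans (by gcongr)).trans h0
    calc ‖Φ θ - θ₀‖ = ‖(Φ θ - Φ θ₀) + (Φ θ₀ - θ₀)‖ := by abel_nf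
      _ ≤ ‖Φ θ - Φ θ₀‖ + ‖Φ θ₀ - θ₀‖ := norm_add_le _ _
      _ ≤ r / 2 := by linarith
  have hcontr : ContractingWith (1 / 2) (hmaps.restrict Φ _ _) := by
    refine ⟨by norm_num, LipschitzWith.of_dist_le_mul fun θ θ' => ?_⟩
    have := hlip θ (hsub θ.2) θ' (hsub θ'.2)
    rw [Subtype.dist_eq, Subtype.dist_eq, dist_eq_norm, dist_eq_norm]
    simpa using this
  obtain ⟨θ, hθ, hfix, -⟩ := ContractingWith.exists_fixedPoint' (f := Φ)
    Metric.isClosed_closedBall.isComplete hmaps hcontr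
    (Metric.mem_closedBall_self (by positivity) : θ₀ ∈ _) (edist_ne_top _ _)
  have hroot : F θ = 0 := by
    have h1 : T (F θ) = 0 := by
      have : θ + T (F θ) = θ := hfix
      simpa using this
    rw [← hAT (F θ), h1, map_zero]
  refine ⟨θ, ⟨Metric.closedBall_subset_ball (by linarith) hθ, hroot⟩, ?_⟩
  rintro θ' ⟨hθ', hroot'⟩
  have := hlip θ' (Metric.ball_subset_closedBall hθ') θ (hsub hθ)
  simp only [hΦ, hroot, hroot', map_zero, _root_.add_zero] at this
  have h3 : ‖θ' - θ‖ = 0 := by linarith [norm_nonneg (θ' - θ)]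
  exact sub_eq_zero.1 (norm_eq_zero.1 h3)

end Root

/-! ### Deterministic score estimates near the true parameter -/

section Local

variable {E : Type*} [NormedAddCommGroup E] [InnerProductSpace ℝ E]

/-- Uniform control of functions `g i` with gradients `G i` near `θ₀`, where `g i θ₀ = 1`. -/
structure LocalModel (g : ℕ → E → ℝ) (G : ℕ → E → E) (θ₀ : E) (ρ c : ℝ) (M N : ℕ → ℝ) (K : ℝ) :
    Prop where
  hρ : 0 < ρ
  hc : 0 < c
  hM : ∀ i, 0 ≤ M i
  hN : ∀ i, 0 ≤ N i
  g_center : ∀ i, g i θ₀ = 1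
  g_ge : ∀ i, ∀ θ ∈ Metric.ball θ₀ ρ, c ≤ g i θ
  G_le : ∀ i, ∀ θ ∈ Metric.ball θ₀ ρ, ‖G i θ‖ ≤ M i
  g_lip : ∀ i, ∀ θ ∈ Metric.ball θ₀ ρ, ∀ θ' ∈ Metric.ball θ₀ ρ, |g i θ - g i θ'| ≤ M i * ‖θ - θ'‖
  G_lip : ∀ i, ∀ θ ∈ Metric.ball θ₀ ρ, ∀ θ' ∈ Metric.ball θ₀ ρ, ‖G i θ - G i θ'‖ ≤ N i * ‖θ - θ'‖
  g_taylor : ∀ i, ∀ r < ρ, ∀ θ ∈ Metric.closedBall θ₀ r, ∀ θ' ∈ Metric.closedBall θ₀ r,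
    |g i θ - g i θ' - inner ℝ (G i θ₀) (θ - θ')| ≤ N i * r * ‖θ - θ'‖
  sum_M : ∀ᶠ n : ℕ in atTop, ∑ i ∈ Finset.range n, M i ^ 3 ≤ K * n
  sum_N : ∀ᶠ n : ℕ in atTop, ∑ i ∈ Finset.range n, (1 + M i) * N i ≤ K * n

/-- The properties of the function `φ` with score `∑ φ (σ ε_i) (g_i θ) ∇g_i θ` which are used in the
asymptotic analysis; `a` is the coefficient of `s ^ 2` in the expansion of `φ s 1`. -/
structure ScoreKernel (φ : ℝ → ℝ → ℝ) (a c C : ℝ) : Prop where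
  nonneg : 0 ≤ C
  expand : ∀ s, |s| ≤ 1 / 2 → |φ s 1 - s - a * s ^ 2| ≤ C * |s| * s ^ 2
  bound : ∀ s u, |s| ≤ 1 / 2 → c ≤ u → |φ s u| ≤ C * (|s| + |u - 1|)
  lip : ∀ s t u v, |s| ≤ 1 / 2 → c ≤ u → c ≤ v → |u - 1| ≤ t → |v - 1| ≤ t →
    |φ s u - φ s v + (u - v)| ≤ C * (|s| + t) * |u - v|

variable {g : ℕ → E → ℝ} {G : ℕ → E → E} {θ₀ : E} {ρ c : ℝ} {M N : ℕ → ℝ} {K : ℝ}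
  {φ : ℝ → ℝ → ℝ} {a C : ℝ}

/-- The difference of the two sides is `(m - 1)² (m + 1)`. Thus the bound on `∑ M³` also controls `∑
M` and `∑ M²`. -/
theorem add_sq_le_one_add_cube {m : ℝ} (hm : 0 ≤ m) : m + m ^ 2 ≤ 1 + m ^ 3 := by
  nlinarith [mul_nonneg (sq_nonneg (m - 1)) (by linarith : 0 ≤ m + 1)]

namespace LocalModel

theorem K_nonneg (h : LocalModel g G θ₀ ρ c M N K) : 0 ≤ K := by
  obtain ⟨n, hn, hn0⟩ := (h.sum_M.and (eventually_gt_atTop 0)).exists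
  have : 0 ≤ K * n := (Finset.sum_nonneg fun i _ => pow_nonneg (h.hM i) 3).trans hn
  exact nonneg_of_mul_nonneg_left this (by exact_mod_cast hn0)

theorem sum_add_sq (h : LocalModel g G θ₀ ρ c M N K) :
    ∀ᶠ n : ℕ in atTop, ∑ i ∈ Finset.range n, (M i + M i ^ 2) ≤ (1 + K) * n := by
  filter_upwards [h.sum_M] with n hn
  calc _ ≤ ∑ i ∈ Finset.range n, (1 + M i ^ 3) :=
        Finset.sum_le_sum fun i _ => add_sq_le_one_add_cube (h.hM i)
    _ = n + ∑ i ∈ Finset.range n, M i ^ 3 := by simp [Finset.sum_add_distrib]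
    _ ≤ _ := by linarith

theorem sum_M_one (h : LocalModel g G θ₀ ρ c M N K) :
    ∀ᶠ n : ℕ in atTop, ∑ i ∈ Finset.range n, M i ≤ (1 + K) * n := by
  filter_upwards [h.sum_add_sq] with n hn
  exact (Finset.sum_le_sum fun i _ => le_add_of_nonneg_right (sq_nonneg _)).trans hn

theorem sum_M_sq (h : LocalModel g G θ₀ ρ c M N K) :
    ∀ᶠ n : ℕ in atTop, ∑ i ∈ Finset.range n, M i ^ 2 ≤ (1 + K) * n := by
  filter_upwards [h.sum_add_sq] with n hn
  exact (Finset.sum_le_sum fun i _ => le_add_of_nonneg_left (h.hM i)).trans hn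

theorem center_mem (h : LocalModel g G θ₀ ρ c M N K) : θ₀ ∈ Metric.ball θ₀ ρ :=
  Metric.mem_ball_self h.hρ

theorem norm_center_le (h : LocalModel g G θ₀ ρ c M N K) (i : ℕ) : ‖G i θ₀‖ ≤ M i :=
  h.G_le i θ₀ h.center_mem

/-- The largest envelope among the first `n` is `o(√n)`. -/
theorem eventually_le_sqrt (h : LocalModel g G θ₀ ρ c M N K) {η : ℝ} (hη : 0 < η) :
    ∀ᶠ n : ℕ in atTop, ∀ i < n, M i ≤ η * √(n : ℝ) := by
  have hs : Tendsto (fun n : ℕ => √(n : ℝ)) atTop atTop :=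
    Real.tendsto_sqrt_atTop.comp tendsto_natCast_atTop_atTop
  filter_upwards [h.sum_M, hs.eventually_ge_atTop (K / η ^ 3), eventually_gt_atTop 0]
    with n hn hK hn0 i hi
  have h1 : M i ^ 3 ≤ K * n := (Finset.single_le_sum (fun j _ => pow_nonneg (h.hM j) 3)
    (Finset.mem_range.2 hi)).trans hn
  have h2 : K ≤ η ^ 3 * √(n : ℝ) := by
    rw [div_le_iff₀ (by positivity)] at hK
    linarith
  refine le_of_pow_le_pow_left₀ (n := 3) (by norm_num) (by positivity) ?_
  calc M i ^ 3 ≤ K * n := h1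
    _ ≤ η ^ 3 * √(n : ℝ) * n := by gcongr
    _ = η ^ 3 * √(n : ℝ) * (√(n : ℝ) ^ 2) := by rw [Real.sq_sqrt (Nat.cast_nonneg n)]
    _ = _ := by ring

/-- The kernel moves like `-u`, and `g i` moves like its linearization at `θ₀`. The error of the
kernel carries a factor `η + M r` and meets two further factors `M`, which is where `M³` is needed;
variation of the gradient brings in `(1 + M) N`. -/
theorem term_lip (h : LocalModel g G θ₀ ρ c M N K) (hφ : ScoreKernel φ a c C) {i : ℕ}
    {s η r : ℝ} (hs : |s| ≤ η) (hη : η ≤ 1 / 2) (hr : r < ρ) {θ θ' : E}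
    (hθ : θ ∈ Metric.closedBall θ₀ r) (hθ' : θ' ∈ Metric.closedBall θ₀ r) :
    ‖φ s (g i θ) • G i θ - φ s (g i θ') • G i θ' + inner ℝ (G i θ₀) (θ - θ') • G i θ₀‖ ≤
      (C + 2) * ((1 + M i) * N i + 1 + 2 * M i ^ 3) * (η + r) * ‖θ - θ'‖ := by
  have hb := Metric.closedBall_subset_ball (x := θ₀) hr hθ
  have hb' := Metric.closedBall_subset_ball (x := θ₀) hr hθ'
  have hr0 : 0 ≤ r := dist_nonneg.trans (Metric.mem_closedBall.1 hθ)
  have hη0 : 0 ≤ η := (abs_nonneg s).trans hs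
  have hM := h.hM i
  have hN := h.hN i
  have hC := hφ.nonneg
  have hg1 : ∀ θ ∈ Metric.closedBall θ₀ r, |g i θ - 1| ≤ M i * r := fun θ hθ => by
    rw [← h.g_center i]
    refine (h.g_lip i θ (Metric.closedBall_subset_ball hr hθ) θ₀ h.center_mem).trans ?_
    gcongr
    exact mem_closedBall_iff_norm.1 hθ
  have hG1 : ‖G i θ' - G i θ₀‖ ≤ N i * r := by
    refine (h.G_lip i θ' hb' θ₀ h.center_mem).trans ?_
    gcongr
    exact mem_closedBall_iff_norm.1 hθ'
  set d := ‖θ - θ'‖ with hd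
  have hd0 : 0 ≤ d := norm_nonneg _
  have t1 : ‖φ s (g i θ) • (G i θ - G i θ')‖ ≤ C * (η + M i * r) * (N i * d) := by
    rw [norm_smul, Real.norm_eq_abs]
    have := hφ.bound s _ (hs.trans hη) (h.g_ge i θ hb)
    have h2 : |φ s (g i θ)| ≤ C * (η + M i * r) := this.trans (by gcongr; exact hg1 θ hθ)
    gcongr
    exact h.G_lip i θ hb θ' hb'
  have t2 : ‖(φ s (g i θ) - φ s (g i θ') + (g i θ - g i θ')) • G i θ'‖ ≤
      C * (η + M i * r) * (M i * d) * M i := by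
    rw [norm_smul, Real.norm_eq_abs]
    have := hφ.lip s _ _ _ (hs.trans hη) (h.g_ge i θ hb) (h.g_ge i θ' hb') (hg1 θ hθ) (hg1 θ' hθ')
    have h2 : |φ s (g i θ) - φ s (g i θ') + (g i θ - g i θ')| ≤ C * (η + M i * r) * (M i * d) :=
      this.trans (by gcongr; exact h.g_lip i θ hb θ' hb')
    gcongr
    exact h.G_le i θ' hb'
  have t3 : ‖(g i θ - g i θ') • (G i θ' - G i θ₀)‖ ≤ M i * d * (N i * r) := by
    rw [norm_smul, Real.norm_eq_abs]
    gcongr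
    exact h.g_lip i θ hb θ' hb'
  have t4 : ‖(g i θ - g i θ' - inner ℝ (G i θ₀) (θ - θ')) • G i θ₀‖ ≤ N i * r * d * M i := by
    rw [norm_smul, Real.norm_eq_abs]
    gcongr
    · exact h.g_taylor i r hr θ hθ θ' hθ'
    · exact h.norm_center_le i
  -- Four errors are separated: change of `G`, deviation of the kernel from `-u`, replacement of `G`
  -- by its value at the centre, and the Taylor remainder of `g`.
  have key : φ s (g i θ) • G i θ - φ s (g i θ') • G i θ' + inner ℝ (G i θ₀) (θ - θ') • G i θ₀ =
      φ s (g i θ) • (G i θ - G i θ') + (φ s (g i θ) - φ s (g i θ') + (g i θ - g i θ')) • G i θ' -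
      (g i θ - g i θ') • (G i θ' - G i θ₀) -
      (g i θ - g i θ' - inner ℝ (G i θ₀) (θ - θ')) • G i θ₀ := by
    module
  rw [key]
  refine (norm_sub_le _ _).trans ?_
  have n1 := norm_sub_le (φ s (g i θ) • (G i θ - G i θ') +
    (φ s (g i θ) - φ s (g i θ') + (g i θ - g i θ')) • G i θ') ((g i θ - g i θ') • (G i θ' - G i θ₀))
  have n2 := norm_add_le (φ s (g i θ) • (G i θ - G i θ'))
    ((φ s (g i θ) - φ s (g i θ') + (g i θ - g i θ')) • G i θ')
  have hmr : η + M i * r ≤ (1 + M i) * (η + r) := by nlinarith [mul_nonneg hM hη0]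
  have hm2 : M i ^ 2 ≤ 1 + M i ^ 3 := by
    linarith [add_sq_le_one_add_cube hM]
  calc _ ≤ C * (η + M i * r) * (N i + M i ^ 2) * d + 2 * (M i * N i) * r * d := by linarith
    _ ≤ C * ((1 + M i) * (η + r)) * (N i + M i ^ 2) * d + 2 * (M i * N i) * (η + r) * d := by
        gcongr
        linarith
    _ = (C * ((1 + M i) * N i + M i ^ 2 + M i ^ 3) + 2 * (M i * N i)) * ((η + r) * d) := by ring
    _ ≤ ((C + 2) * ((1 + M i) * N i + 1 + 2 * M i ^ 3)) * ((η + r) * d) := by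
        refine mul_le_mul_of_nonneg_right ?_ (by positivity)
        have e1 : C * ((1 + M i) * N i + M i ^ 2 + M i ^ 3) ≤
            C * ((1 + M i) * N i + 1 + 2 * M i ^ 3) := by
          gcongr ?_ * ?_
          linarith
        have : 0 ≤ M i ^ 3 := by positivity
        nlinarith
    _ = _ := by ring

theorem score_lip (h : LocalModel g G θ₀ ρ c M N K) (hφ : ScoreKernel φ a c C) :
    ∀ᶠ n : ℕ in atTop, ∀ (s : ℕ → ℝ) (η r : ℝ), (∀ i < n, |s i| ≤ η) → 0 ≤ η → η ≤ 1 / 2 → r < ρ →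
      ∀ θ ∈ Metric.closedBall θ₀ r, ∀ θ' ∈ Metric.closedBall θ₀ r,
      ‖∑ i ∈ Finset.range n, φ (s i) (g i θ) • G i θ -
        ∑ i ∈ Finset.range n, φ (s i) (g i θ') • G i θ' +
        ∑ i ∈ Finset.range n, inner ℝ (G i θ₀) (θ - θ') • G i θ₀‖ ≤
      n * ((C + 2) * (3 * K + 1) * (η + r) * ‖θ - θ'‖) := by
  filter_upwards [h.sum_M, h.sum_N] with n hM hN s η r hs hη0 hη hr θ hθ θ' hθ'
  have hr0 : 0 ≤ r := dist_nonneg.trans (Metric.mem_closedBall.1 hθ)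
  have hC := hφ.nonneg
  rw [← Finset.sum_sub_distrib, ← Finset.sum_add_distrib]
  calc _ ≤ ∑ i ∈ Finset.range n,
        (C + 2) * ((1 + M i) * N i + 1 + 2 * M i ^ 3) * (η + r) * ‖θ - θ'‖ :=
        norm_sum_le_of_le _ fun i hi =>
          h.term_lip hφ (hs i (Finset.mem_range.1 hi)) hη hr hθ hθ'
    _ = (C + 2) * (∑ i ∈ Finset.range n, (1 + M i) * N i + n +
          2 * ∑ i ∈ Finset.range n, M i ^ 3) * (η + r) * ‖θ - θ'‖ := by
        rw [← Finset.sum_mul, ← Finset.sum_mul, ← Finset.mul_sum, Finset.sum_add_distrib,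
          Finset.sum_add_distrib, ← Finset.mul_sum]
        simp
    _ ≤ (C + 2) * (K * n + n + 2 * (K * n)) * (η + r) * ‖θ - θ'‖ := by gcongr
    _ = _ := by ring

theorem score_center_le (h : LocalModel g G θ₀ ρ c M N K) (hφ : ScoreKernel φ a c C) :
    ∀ᶠ n : ℕ in atTop, ∀ (s : ℕ → ℝ) (η : ℝ), (∀ i < n, |s i| ≤ η) → 0 ≤ η → η ≤ 1 / 2 →
      ‖∑ i ∈ Finset.range n, φ (s i) (g i θ₀) • G i θ₀‖ ≤ n * (C * (1 + K) * η) := by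
  filter_upwards [h.sum_M_one] with n hM s η hs hη0 hη
  have hC := hφ.nonneg
  calc _ ≤ ∑ i ∈ Finset.range n, C * η * M i := norm_sum_le_of_le _ fun i hi => by
        have hsi := hs i (Finset.mem_range.1 hi)
        have := hφ.bound (s i) _ (hsi.trans hη) (h.g_ge i θ₀ h.center_mem)
        rw [h.g_center, sub_self, abs_zero, _root_.add_zero] at this
        rw [norm_smul, Real.norm_eq_abs, h.g_center]
        have h2 : |φ (s i) 1| ≤ C * η := this.trans (by gcongr)
        gcongr
        exact h.norm_center_le i
    _ = C * η * ∑ i ∈ Finset.range n, M i := by rw [Finset.mul_sum]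
    _ ≤ C * η * ((1 + K) * n) := by gcongr
    _ = _ := by ring

/-- Only one of the three factors `|s|` in the remainder is bounded by `η`. The remaining `s ^ 2` is
kept random, so that its expectation can be used after scaling. -/
theorem score_center_expand (h : LocalModel g G θ₀ ρ c M N K) (hφ : ScoreKernel φ a c C)
    {n : ℕ} {s : ℕ → ℝ} {η : ℝ} (hs : ∀ i < n, |s i| ≤ η) (hη : η ≤ 1 / 2) :
    ‖∑ i ∈ Finset.range n, φ (s i) (g i θ₀) • G i θ₀ -
      ∑ i ∈ Finset.range n, (s i + a * s i ^ 2) • G i θ₀‖ ≤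
      C * η * ∑ i ∈ Finset.range n, s i ^ 2 * M i := by
  have hC := hφ.nonneg
  rw [← Finset.sum_sub_distrib, Finset.mul_sum]
  refine norm_sum_le_of_le _ fun i hi => ?_
  have hsi := hs i (Finset.mem_range.1 hi)
  rw [← sub_smul, norm_smul, Real.norm_eq_abs, h.g_center]
  have h1 := hφ.expand (s i) (hsi.trans hη)
  have h2 : |φ (s i) 1 - (s i + a * s i ^ 2)| ≤ C * η * s i ^ 2 := by
    rw [← sub_sub]
    exact h1.trans (by gcongr)
  have hη0 : 0 ≤ η := (abs_nonneg _).trans hsi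
  calc _ ≤ C * η * s i ^ 2 * M i := by
        gcongr
        exact h.norm_center_le i
    _ = _ := by ring

end LocalModel

end Local

/-! ### Expansions of the two score kernels -/

section Kernels

/-- The score kernel of weighted least squares. -/
noncomputable def wlsKernel (s u : ℝ) : ℝ := (1 + s) * ((1 + s) - u) / u ^ 3

/-- The score kernel of data weighted least squares. -/
noncomputable def dwlsKernel (s u : ℝ) : ℝ := ((1 + s) - u) / (1 + s) ^ 2

theorem abs_one_add_sub_le (s u : ℝ) : |(1 + s) - u| ≤ |s| + |u - 1| := by
  calc |(1 + s) - u| = |s - (u - 1)| := by ring_nf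
    _ ≤ _ := abs_sub _ _

theorem abs_mul_sub_one_le (x y : ℝ) : |x * y - 1| ≤ |x - 1| * |y| + |y - 1| := by
  calc |x * y - 1| = |(x - 1) * y + (y - 1)| := by ring_nf
    _ ≤ |(x - 1) * y| + |y - 1| := abs_add_le _ _
    _ = _ := by rw [abs_mul]

theorem inv_one_add_sq_le {s : ℝ} (hs : |s| ≤ 1 / 2) : 0 < (1 + s) ^ 2 ∧ ((1 + s) ^ 2)⁻¹ ≤ 4 ∧
    1 + s ≠ 0 := by
  have h1 : 1 / 2 ≤ 1 + s := by linarith [neg_abs_le s]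
  have h2 : 1 / 4 ≤ (1 + s) ^ 2 := by nlinarith
  refine ⟨by linarith, ?_, by linarith⟩
  rw [inv_le_comm₀ (by linarith) (by norm_num)]
  linarith

/-- The kernel is affine in `u` with slope `-(1 + s)⁻²`, so every estimate reduces to `1 + s ≥ 1 /
2`. -/
theorem dwlsKernel_scoreKernel (c : ℝ) : ScoreKernel dwlsKernel (-2) c 16 where
  nonneg := by norm_num
  expand s hs := by
    obtain ⟨h1, h2, hne⟩ := inv_one_add_sq_le hs
    have e : dwlsKernel s 1 - s - -2 * s ^ 2 = s * s ^ 2 * (3 + 2 * s) * ((1 + s) ^ 2)⁻¹ := by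
      rw [dwlsKernel]
      field_simp
      ring
    rw [e, abs_mul, abs_mul, abs_mul, abs_of_pos (inv_pos.2 h1), abs_of_nonneg (sq_nonneg s)]
    have h3 : |3 + 2 * s| ≤ 4 := by
      rw [abs_le] at hs ⊢
      constructor <;> linarith
    calc |s| * s ^ 2 * |3 + 2 * s| * ((1 + s) ^ 2)⁻¹ ≤ |s| * s ^ 2 * 4 * 4 := by gcongr
      _ = _ := by ring
  bound s u hs _ := by
    obtain ⟨h1, h2, hne⟩ := inv_one_add_sq_le hs
    rw [dwlsKernel, div_eq_mul_inv, abs_mul, abs_of_pos (inv_pos.2 h1)]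
    have h3 := abs_one_add_sub_le s u
    calc _ ≤ (|s| + |u - 1|) * 4 := by gcongr
      _ ≤ _ := by linarith [abs_nonneg s, abs_nonneg (u - 1)]
  lip s t u v hs _ _ hu _ := by
    obtain ⟨h1, h2, hne⟩ := inv_one_add_sq_le hs
    have e : dwlsKernel s u - dwlsKernel s v + (u - v) =
        s * (2 + s) * ((1 + s) ^ 2)⁻¹ * (u - v) := by
      rw [dwlsKernel, dwlsKernel]
      field_simp
      ring
    rw [e, abs_mul, abs_mul, abs_mul, abs_of_pos (inv_pos.2 h1)]
    have h3 : |2 + s| ≤ 4 := by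
      rw [abs_le] at hs ⊢
      constructor <;> linarith
    have ht : 0 ≤ t := (abs_nonneg _).trans hu
    refine mul_le_mul_of_nonneg_right ?_ (abs_nonneg _)
    calc |s| * |2 + s| * ((1 + s) ^ 2)⁻¹ ≤ |s| * 4 * 4 := by gcongr
      _ ≤ _ := by linarith

theorem wlsKernel_scoreKernel {c : ℝ} (hc : 0 < c) : ∃ C, ScoreKernel wlsKernel 1 c C := by
  set B := c⁻¹ with hB
  have hB0 : 0 < B := inv_pos.2 hc
  -- A sum of nonnegative terms that dominates each coefficient arising below; it is not optimized.
  set C := 2 * B ^ 3 + B ^ 2 * (8 * B ^ 2 + 2 * B) + (B * (B + 1)) * (7 * B ^ 2 + 3 * B) +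
    B ^ 2 * (3 * (B * (B + 1)) + 2 * B) + (8 * B ^ 2 + 2 * B) + (3 * (B * (B + 1)) + 2 * B) with hC
  have hC0 : 0 ≤ C := by positivity
  refine ⟨C, hC0, fun s _ => ?_, fun s u hs hu => ?_, fun s t u v hs hu hv hut hvt => ?_⟩
  -- At `u = 1` the kernel is exactly `(1 + s) s`, without cubic remainder.
  · have : wlsKernel s 1 - s - 1 * s ^ 2 = 0 := by
      rw [wlsKernel]; ring
    rw [this, abs_zero]
    positivity
  · have hu0 : 0 < u := hc.trans_le hu
    have hinv : u⁻¹ ≤ B := inv_anti₀ hc hu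
    rw [wlsKernel, div_eq_mul_inv, abs_mul, abs_mul, ← inv_pow, abs_of_pos (by positivity : 0 < u⁻¹ ^ 3)]
    have h1 : |1 + s| ≤ 2 := by
      rw [abs_le] at hs ⊢
      constructor <;> linarith
    have h2 := abs_one_add_sub_le s u
    calc |1 + s| * |(1 + s) - u| * u⁻¹ ^ 3 ≤ 2 * (|s| + |u - 1|) * B ^ 3 := by gcongr
      _ = 2 * B ^ 3 * (|s| + |u - 1|) := by ring
      _ ≤ C * (|s| + |u - 1|) := by
        refine mul_le_mul_of_nonneg_right ?_ (by positivity)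
        rw [hC]
        have : 0 ≤ B ^ 2 * (8 * B ^ 2 + 2 * B) + (B * (B + 1)) * (7 * B ^ 2 + 3 * B) +
          B ^ 2 * (3 * (B * (B + 1)) + 2 * B) + (8 * B ^ 2 + 2 * B) +
          (3 * (B * (B + 1)) + 2 * B) := by positivity
        linarith
  · have hu0 : 0 < u := hc.trans_le hu
    have hv0 : 0 < v := hc.trans_le hv
    have ht : 0 ≤ t := (abs_nonneg _).trans hut
    set b := u⁻¹ with hb
    set b' := v⁻¹ with hb'
    have hbB : b ≤ B := inv_anti₀ hc hu
    have hbB' : b' ≤ B := inv_anti₀ hc hv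
    have hb0 : 0 < b := inv_pos.2 hu0
    have hb0' : 0 < b' := inv_pos.2 hv0
    set w := 1 + s with hw
    set D := b * b' with hD
    set Q := w ^ 2 * (b ^ 2 + D + b' ^ 2) - w * (b + b') with hQ
    -- The factor `u - v` is extracted from the differences of `u⁻³` and `u⁻²`. At `s = 0`, `u = v =
    -- 1` both `D` and `Q` equal `1`, so `1 - D * Q` is of order `|s| + t`.
    have key : wlsKernel s u - wlsKernel s v + (u - v) = (1 - D * Q) * (u - v) := by
      rw [wlsKernel, wlsKernel, hQ, hD, hb, hb', ← hw]
      field_simp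
      ring
    have hx : |b - 1| ≤ B * t := by
      have : b - 1 = b * (1 - u) := by rw [hb]; field_simp
      rw [this, abs_mul, abs_of_pos hb0, abs_sub_comm]
      gcongr
    have hx' : |b' - 1| ≤ B * t := by
      have : b' - 1 = b' * (1 - v) := by rw [hb']; field_simp
      rw [this, abs_mul, abs_of_pos hb0', abs_sub_comm]
      gcongr
    have hprod : ∀ x y : ℝ, 0 < y → y ≤ B → |x - 1| ≤ B * t → |y - 1| ≤ B * t →
        |x * y - 1| ≤ B * (B + 1) * t := by
      intro x y hy hyB h1 h2
      have := abs_mul_sub_one_le x y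
      rw [abs_of_pos hy] at this
      calc _ ≤ B * t * B + B * t := this.trans (by gcongr)
        _ = _ := by ring
    have hD1 := hprod b b' hb0' hbB' hx hx'
    have hb2 := hprod b b hb0 hbB hx hx
    have hb2' := hprod b' b' hb0' hbB' hx' hx'
    have hDB : |D| ≤ B ^ 2 := by
      rw [hD, abs_of_pos (by positivity), sq]
      gcongr
    have hw1 : |w| ≤ 3 / 2 := by
      rw [abs_le] at hs ⊢
      constructor <;> linarith
    have hw2 : |w ^ 2 - 1| ≤ 5 / 2 * |s| := by
      have : w ^ 2 - 1 = (2 + s) * s := by rw [hw]; ring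
      rw [this, abs_mul]
      gcongr
      rw [abs_le] at hs ⊢
      constructor <;> linarith
    have hS : |b ^ 2 + D + b' ^ 2| ≤ 3 * B ^ 2 := by
      rw [abs_of_pos (by positivity), hD]
      calc b ^ 2 + b * b' + b' ^ 2 ≤ B ^ 2 + B * B + B ^ 2 := by gcongr
        _ = _ := by ring
    have hS' : |b + b'| ≤ 2 * B := by
      rw [abs_of_pos (by positivity)]
      linarith
    have hQB : |Q| ≤ 7 * B ^ 2 + 3 * B := by
      calc |Q| ≤ |w ^ 2 * (b ^ 2 + D + b' ^ 2)| + |w * (b + b')| := abs_sub _ _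
        _ = |w| ^ 2 * |b ^ 2 + D + b' ^ 2| + |w| * |b + b'| := by rw [abs_mul, abs_mul, abs_pow]
        _ ≤ (3 / 2) ^ 2 * (3 * B ^ 2) + (3 / 2) * (2 * B) := by gcongr
        _ ≤ _ := by nlinarith [sq_nonneg B]
    have hQ1 : |Q - 1| ≤ (8 * B ^ 2 + 2 * B) * |s| + (3 * (B * (B + 1)) + 2 * B) * t := by
      have e : Q - 1 = (w ^ 2 - 1) * (b ^ 2 + D + b' ^ 2) + (b * b - 1) + (b * b' - 1) +
          (b' * b' - 1) - s * (b + b') - (b - 1) - (b' - 1) := by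
        rw [hQ, hD, hw]; ring
      have f1 : |(w ^ 2 - 1) * (b ^ 2 + D + b' ^ 2)| ≤ 5 / 2 * |s| * (3 * B ^ 2) := by
        rw [abs_mul]; gcongr
      have f2 : |s * (b + b')| ≤ |s| * (2 * B) := by
        rw [abs_mul]; gcongr
      have hsB : 0 ≤ |s| * B ^ 2 := by positivity
      have g1 := abs_le.1 f1
      have g2 := abs_le.1 f2
      have g3 := abs_le.1 hD1
      have g4 := abs_le.1 hb2
      have g5 := abs_le.1 hb2'
      have g6 := abs_le.1 hx
      have g7 := abs_le.1 hx'
      rw [e, abs_le]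
      constructor <;> linarith
    have hfin : |1 - D * Q| ≤ C * (|s| + t) := by
      have e : 1 - D * Q = -((D - 1) * Q + (Q - 1)) := by ring
      rw [e, abs_neg]
      calc _ ≤ |(D - 1) * Q| + |Q - 1| := abs_add_le _ _
        _ ≤ (B * (B + 1) * t) * (7 * B ^ 2 + 3 * B) +
            ((8 * B ^ 2 + 2 * B) * |s| + (3 * (B * (B + 1)) + 2 * B) * t) := by
            rw [abs_mul]; gcongr
        _ = (8 * B ^ 2 + 2 * B) * |s| +
            (B * (B + 1) * (7 * B ^ 2 + 3 * B) + (3 * (B * (B + 1)) + 2 * B)) * t := by ring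
        _ ≤ C * |s| + C * t := by
            have p1 : 0 ≤ B ^ 3 := by positivity
            have p2 : 0 ≤ B ^ 2 * (8 * B ^ 2 + 2 * B) := by positivity
            have p3 : 0 ≤ (B * (B + 1)) * (7 * B ^ 2 + 3 * B) := by positivity
            have p4 : 0 ≤ B ^ 2 * (3 * (B * (B + 1)) + 2 * B) := by positivity
            have p5 : 0 ≤ 8 * B ^ 2 + 2 * B := by positivity
            have p6 : 0 ≤ 3 * (B * (B + 1)) + 2 * B := by positivity
            gcongr <;> rw [hC] <;> linarith
        _ = _ := by ring
    rw [key, abs_mul]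
    gcongr

end Kernels

/-! ### From the regularity conditions to the relative model -/

section Model

variable {X : Type*} {p : ℕ}

/-- The mean function relative to its value at `θ₀`. -/
noncomputable def relMean (f : X → Par p → ℝ) (x : ℕ → X) (θ₀ : Par p) (i : ℕ) (θ : Par p) : ℝ :=
  f (x i) θ / f (x i) θ₀

/-- The gradient at `θ` relative to the value of the mean function at `θ₀`. -/
noncomputable def relGradAt (f : X → Par p → ℝ) (x : ℕ → X) (θ₀ : Par p) (i : ℕ) (θ : Par p) :
    Par p :=
  (f (x i) θ₀)⁻¹ • gradient (f (x i)) θ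

variable {f : X → Par p → ℝ} {x : ℕ → X} {θ₀ : Par p}

theorem norm_gradient_sub (h : Par p → ℝ) (θ θ' : Par p) :
    ‖gradient h θ - gradient h θ'‖ = ‖fderiv ℝ h θ - fderiv ℝ h θ'‖ := by
  rw [gradient, gradient, ← map_sub, LinearIsometryEquiv.norm_map]

theorem norm_gradient (h : Par p → ℝ) (θ : Par p) : ‖gradient h θ‖ = ‖fderiv ℝ h θ‖ := by
  rw [gradient, LinearIsometryEquiv.norm_map]

theorem inner_gradient (h : Par p → ℝ) (θ v : Par p) :
    inner ℝ (gradient h θ) v = fderiv ℝ h θ v := by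
  rw [← InnerProductSpace.toDual_apply_apply (𝕜 := ℝ), gradient,
    LinearIsometryEquiv.apply_symm_apply]

theorem Regular.exists_localModel (h : Regular f x θ₀) : ∃ ρ c M N K,
    LocalModel (relMean f x θ₀) (relGradAt f x θ₀) θ₀ ρ c M N K ∧
    ∀ i a b, |relHess f x θ₀ i a b| ≤ N i := by
  obtain ⟨h0, ρ, hρ, c, hc, M, N, hC2, hlow, hgrad, hhess, hMO, hNO⟩ := h
  have hctr : θ₀ ∈ Metric.ball θ₀ ρ := Metric.mem_ball_self hρ
  have hpos : ∀ i, 0 < |f (x i) θ₀| := fun i => abs_pos.2 (h0 i)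
  have hM0 : ∀ i, 0 ≤ M i := fun i =>
    nonneg_of_mul_nonneg_left ((norm_nonneg _).trans (hgrad i θ₀ hctr)) (hpos i)
  have hN0 : ∀ i, 0 ≤ N i := fun i =>
    nonneg_of_mul_nonneg_left ((norm_nonneg (fderiv ℝ (fderiv ℝ (f (x i))) θ₀)).trans
      (hhess i θ₀ hctr)) (hpos i)
  have hd1 : ∀ i, ∀ θ ∈ Metric.ball θ₀ ρ, DifferentiableAt ℝ (f (x i)) θ := fun i θ hθ =>
    ((hC2 i).contDiffAt (Metric.isOpen_ball.mem_nhds hθ)).differentiableAt (by norm_num)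
  have hd2 : ∀ i, ∀ θ ∈ Metric.ball θ₀ ρ, DifferentiableAt ℝ (fderiv ℝ (f (x i))) θ :=
    fun i θ hθ => (((hC2 i).contDiffAt (Metric.isOpen_ball.mem_nhds hθ)).fderiv_right
      (m := 1) (by norm_num)).differentiableAt (by norm_num)
  have hconv := convex_ball θ₀ ρ
  have hflip : ∀ i, ∀ θ ∈ Metric.ball θ₀ ρ, ∀ θ' ∈ Metric.ball θ₀ ρ,
      ‖fderiv ℝ (f (x i)) θ - fderiv ℝ (f (x i)) θ'‖ ≤ N i * |f (x i) θ₀| * ‖θ - θ'‖ :=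
    fun i θ hθ θ' hθ' => hconv.norm_image_sub_le_of_norm_fderiv_le (hd2 i) (hhess i) hθ' hθ
  obtain ⟨K₁, hK₁⟩ := hMO.bound
  obtain ⟨K₂, hK₂⟩ := hNO.bound
  have hbnd : ∀ {u : ℕ → ℝ} {k : ℝ},
      (∀ᶠ n : ℕ in atTop, ‖∑ i ∈ Finset.range n, u i‖ ≤ k * ‖(n : ℝ)‖) → k ≤ max K₁ K₂ →
      ∀ᶠ n : ℕ in atTop, ∑ i ∈ Finset.range n, u i ≤ max K₁ K₂ * n := by
    intro u k hu hk
    filter_upwards [hu] with n hn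
    rw [Real.norm_natCast] at hn
    exact (Real.le_norm_self _).trans (hn.trans (by gcongr))
  refine ⟨ρ, c, M, N, max K₁ K₂, ⟨hρ, hc, hM0, hN0, fun i => div_self (h0 i), ?_, ?_, ?_, ?_, ?_,
    hbnd hK₁ (le_max_left _ _), hbnd hK₂ (le_max_right _ _)⟩, ?_⟩
  · intro i θ hθ
    have habs : ∀ θ ∈ Metric.ball θ₀ ρ, c ≤ |relMean f x θ₀ i θ| := fun θ hθ => by
      rw [relMean, abs_div, le_div_iff₀ (hpos i)]
      exact hlow i θ hθ
    have hcont : ContinuousOn (relMean f x θ₀ i) (Metric.ball θ₀ ρ) :=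
      fun θ hθ => ((hd1 i θ hθ).continuousAt.div_const _).continuousWithinAt
    -- The hypothesis bounds only the absolute value from below. A nonpositive value would force a
    -- zero by the intermediate value theorem, since the relative mean is `1` at `θ₀`.
    by_contra hlt
    have hneg : relMean f x θ₀ i θ ≤ 0 := by
      by_contra hp
      have := habs θ hθ
      rw [abs_of_pos (not_le.1 hp)] at this
      exact hlt this
    have h1 : relMean f x θ₀ i θ₀ = 1 := div_self (h0 i)
    obtain ⟨z, hz, hz0⟩ := hconv.isPreconnected.intermediate_value hθ hctr hcont
      (show (0 : ℝ) ∈ Set.Icc _ _ from ⟨hneg, by rw [h1]; norm_num⟩)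
    have := habs z hz
    rw [hz0, abs_zero] at this
    linarith
  · intro i θ hθ
    rw [relGradAt, norm_smul, norm_inv, Real.norm_eq_abs, inv_mul_le_iff₀ (hpos i), mul_comm]
    exact hgrad i θ hθ
  · intro i θ hθ θ' hθ'
    have := hconv.norm_image_sub_le_of_norm_fderiv_le (hd1 i)
      (fun z hz => (norm_gradient _ _).symm.trans_le (hgrad i z hz)) hθ' hθ
    rw [relMean, relMean, ← sub_div, abs_div, div_le_iff₀ (hpos i)]
    calc _ ≤ M i * |f (x i) θ₀| * ‖θ - θ'‖ := this
      _ = _ := by ring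
  · intro i θ hθ θ' hθ'
    rw [relGradAt, relGradAt, ← smul_sub, norm_smul, norm_inv, Real.norm_eq_abs,
      inv_mul_le_iff₀ (hpos i), norm_gradient_sub]
    calc _ ≤ _ := hflip i θ hθ θ' hθ'
      _ = _ := by ring
  -- Mean value inequality with the derivative frozen at `θ₀`, not at `θ'`: on the closed ball of
  -- radius `r` the derivative differs from it by at most `N i * |f (x i) θ₀| * r`.
  · intro i r hr θ hθ θ' hθ'
    have hsub := Metric.closedBall_subset_ball (x := θ₀) hr
    have := (convex_closedBall θ₀ r).norm_image_sub_le_of_norm_fderiv_le'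
      (fun z hz => hd1 i z (hsub hz)) (φ := fderiv ℝ (f (x i)) θ₀)
      (C := N i * |f (x i) θ₀| * r) (fun z hz => by
        refine (hflip i z (hsub hz) θ₀ hctr).trans ?_
        have := mem_closedBall_iff_norm.1 hz
        have := hN0 i
        gcongr) hθ' hθ
    have e : relMean f x θ₀ i θ - relMean f x θ₀ i θ' -
        inner ℝ (relGradAt f x θ₀ i θ₀) (θ - θ') =
        (f (x i) θ - f (x i) θ' - fderiv ℝ (f (x i)) θ₀ (θ - θ')) / f (x i) θ₀ := by
      rw [relMean, relMean, relGradAt, real_inner_smul_left, inner_gradient]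
      ring
    rw [e, abs_div, div_le_iff₀ (hpos i)]
    calc _ ≤ _ := this
      _ = _ := by ring
  · intro i a b
    rw [relHess, Matrix.smul_apply, hessian, Matrix.of_apply, smul_eq_mul, abs_mul, abs_inv,
      inv_mul_le_iff₀ (hpos i), mul_comm, ← Real.norm_eq_abs]
    refine (ContinuousLinearMap.le_opNorm₂ _ _ _).trans ?_
    simpa using hhess i θ₀ hctr

/-- The two sums combine through `(y - f)/f² + (y - f)²/f³ = y (y - f)/f³`. -/
theorem wlsScore_eq (h0 : ∀ i, f (x i) θ₀ ≠ 0) {σ : ℝ} {e : ℕ → ℝ} {n : ℕ} {θ : Par p}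
    (hθ : ∀ i, relMean f x θ₀ i θ ≠ 0) :
    wlsScore f x (response f x θ₀ σ e) n θ = ∑ i ∈ Finset.range n,
      wlsKernel (σ * e i) (relMean f x θ₀ i θ) • relGradAt f x θ₀ i θ := by
  rw [wlsScore, ← Finset.sum_add_distrib]
  refine Finset.sum_congr rfl fun i _ => ?_
  have h1 := h0 i
  have h2 : f (x i) θ ≠ 0 := fun h => hθ i (by rw [relMean, h, zero_div])
  rw [← add_smul, relGradAt, smul_smul]
  congr 1
  rw [wlsKernel, relMean, response]
  field_simp
  ring

theorem dwlsScore_eq (h0 : ∀ i, f (x i) θ₀ ≠ 0) {σ : ℝ} {e : ℕ → ℝ} {n : ℕ} {θ : Par p} :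
    dwlsScore f x (response f x θ₀ σ e) n θ = ∑ i ∈ Finset.range n,
      dwlsKernel (σ * e i) (relMean f x θ₀ i θ) • relGradAt f x θ₀ i θ := by
  rw [dwlsScore]
  refine Finset.sum_congr rfl fun i _ => ?_
  have h1 := h0 i
  rw [relGradAt, smul_smul]
  congr 1
  rw [dwlsKernel, relMean, response]
  -- A vanishing response makes both coefficients zero, by the convention for division by zero.
  by_cases hs : 1 + σ * e i = 0
  · simp [hs]
  · field_simp

end Model

/-! ### The Gram matrix and the vanishing of trace-weighted means -/

section Gram

variable {X : Type*} {p : ℕ} {f : X → Par p → ℝ} {x : ℕ → X} {θ₀ : Par p}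

theorem gram_apply (n : ℕ) (a b : Fin p) :
    gram f x θ₀ n a b = ∑ i ∈ Finset.range n, relGrad f x θ₀ i a * relGrad f x θ₀ i b := by
  rw [gram, Matrix.mul_apply, ← Fin.sum_univ_eq_sum_range
    fun i => relGrad f x θ₀ i a * relGrad f x θ₀ i b]
  rfl

theorem toEuclideanCLM_gram (n : ℕ) (v : Par p) :
    Matrix.toEuclideanCLM (n := Fin p) (𝕜 := ℝ) ((n : ℝ)⁻¹ • gram f x θ₀ n) v =
      (n : ℝ)⁻¹ • ∑ i ∈ Finset.range n, inner ℝ (relGrad f x θ₀ i) v • relGrad f x θ₀ i := by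
  rw [map_smul, _root_.smul_apply]
  congr 1
  ext a
  rw [Matrix.ofLp_toEuclideanCLM, WithLp.ofLp_sum, Finset.sum_apply, Matrix.mulVec, dotProduct]
  simp_rw [gram_apply, Finset.sum_mul]
  rw [Finset.sum_comm]
  refine Finset.sum_congr rfl fun i _ => ?_
  simp only [PiLp.smul_apply, PiLp.inner_apply, smul_eq_mul, Finset.sum_mul]
  refine Finset.sum_congr rfl fun b _ => ?_
  simp
  ring

theorem isUnit_det_smul_gram {n : ℕ} (hn : 0 < n) (h : IsUnit (gram f x θ₀ n).det) :
    IsUnit ((n : ℝ)⁻¹ • gram f x θ₀ n).det := by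
  rw [Matrix.det_smul]
  refine IsUnit.mul (IsUnit.pow _ ?_) h
  exact (inv_ne_zero (Nat.cast_ne_zero.2 hn.ne')).isUnit

theorem posSemidef_of_tendsto {A : ℕ → Matrix (Fin p) (Fin p) ℝ} {S : Matrix (Fin p) (Fin p) ℝ}
    (hA : Tendsto A atTop (𝓝 S)) (hpos : ∀ n, (A n).PosSemidef) : S.PosSemidef := by
  refine Matrix.PosSemidef.of_dotProduct_mulVec_nonneg ?_ fun v => ?_
  · refine tendsto_nhds_unique (hA.congr fun n => ((hpos n).1).symm) ?_ |>.symm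
    exact (Continuous.matrix_conjTranspose continuous_id).continuousAt.tendsto.comp hA
  · have hc : Continuous fun B : Matrix (Fin p) (Fin p) ℝ => star v ⬝ᵥ B.mulVec v := by fun_prop
    exact ge_of_tendsto ((hc.tendsto S).comp hA)
      (Eventually.of_forall fun n => (hpos n).dotProduct_mulVec_nonneg v)

theorem posSemidef_inv_gram (n : ℕ) : (((n : ℝ)⁻¹ • gram f x θ₀ n)⁻¹).PosSemidef := by
  refine Matrix.PosSemidef.inv (Matrix.PosSemidef.smul ?_ (by positivity))
  have := Matrix.posSemidef_conjTranspose_mul_self (design f x θ₀ n)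
  rwa [Matrix.conjTranspose_eq_transpose_of_trivial] at this

/-- The entries of `(JᵀJ/n)⁻¹` converge and are therefore bounded, so each trace is `O(k i / n)`.
The normalized sum is then `O(n⁻² ∑ k i * M i) = O(1/n)`. -/
theorem tendsto_weighted_trace_zero {k M : ℕ → ℝ} {D : ℝ} (hk : ∀ i, 0 ≤ k i)
    {Q : ℕ → Matrix (Fin p) (Fin p) ℝ} (hQ : ∀ i a b, |Q i a b| ≤ k i)
    (hJ : ∀ i, ‖relGrad f x θ₀ i‖ ≤ M i)
    (hsum : ∀ᶠ n : ℕ in atTop, ∑ i ∈ Finset.range n, k i * M i ≤ D * n)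
    (hgram : ∀ᶠ n in atTop, IsUnit (gram f x θ₀ n).det) {S : Matrix (Fin p) (Fin p) ℝ}
    (hS : Tendsto (fun n : ℕ => ((n : ℝ)⁻¹ • gram f x θ₀ n)⁻¹) atTop (𝓝 S)) :
    Tendsto (fun n : ℕ => (n : ℝ)⁻¹ • ∑ i ∈ Finset.range n,
      Matrix.trace (Q i * (gram f x θ₀ n)⁻¹) • relGrad f x θ₀ i) atTop (𝓝 0) := by
  set B := ∑ a, ∑ b, (|S a b| + 1) with hB
  have hB0 : 0 ≤ B := by positivity
  have hent : ∀ᶠ n : ℕ in atTop, ∀ a b, |((n : ℝ)⁻¹ • gram f x θ₀ n)⁻¹ a b| ≤ |S a b| + 1 := by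
    refine eventually_all.2 fun a => eventually_all.2 fun b => ?_
    have : Tendsto (fun n : ℕ => |((n : ℝ)⁻¹ • gram f x θ₀ n)⁻¹ a b|) atTop (𝓝 |S a b|) :=
      (((continuous_apply_apply a b).tendsto S).comp hS).abs
    exact (this.eventually_lt_const (by linarith)).mono fun _ => le_of_lt
  rw [tendsto_zero_iff_norm_tendsto_zero]
  have hlim : Tendsto (fun n : ℕ => B * D * (n : ℝ)⁻¹) atTop (𝓝 0) := by
    simpa using (tendsto_inv_atTop_nhds_zero_nat (𝕜 := ℝ)).const_mul (B * D)
  refine squeeze_zero' (Eventually.of_forall fun _ => norm_nonneg _) ?_ hlim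
  filter_upwards [hent, hsum, hgram, eventually_gt_atTop 0] with n hn hs hg hn0
  have hn' : (0 : ℝ) < n := by exact_mod_cast hn0
  set A := ((n : ℝ)⁻¹ • gram f x θ₀ n)⁻¹ with hA
  have hinv : (gram f x θ₀ n)⁻¹ = (n : ℝ)⁻¹ • A := by
    refine Matrix.inv_eq_right_inv ?_
    rw [Matrix.mul_smul, ← Matrix.smul_mul, hA]
    exact Matrix.mul_nonsing_inv _ (isUnit_det_smul_gram hn0 hg)
  have htr : ∀ i, |Matrix.trace (Q i * (gram f x θ₀ n)⁻¹)| ≤ (n : ℝ)⁻¹ * (k i * B) := by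
    intro i
    rw [hinv, Matrix.mul_smul, Matrix.trace_smul, smul_eq_mul, abs_mul,
      abs_of_pos (inv_pos.2 hn')]
    gcongr
    rw [Matrix.trace, hB, Finset.sum_comm, Finset.mul_sum]
    refine (Finset.abs_sum_le_sum_abs _ _).trans (Finset.sum_le_sum fun a _ => ?_)
    rw [Matrix.diag_apply, Matrix.mul_apply, Finset.mul_sum]
    refine (Finset.abs_sum_le_sum_abs _ _).trans (Finset.sum_le_sum fun b _ => ?_)
    rw [abs_mul]
    have := hk i
    gcongr
    · exact hQ i a b
    · exact hn b a
  rw [norm_smul, Real.norm_eq_abs, abs_of_pos (inv_pos.2 hn')]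
  calc _ ≤ (n : ℝ)⁻¹ * ∑ i ∈ Finset.range n, (n : ℝ)⁻¹ * (k i * B) * M i := by
        gcongr
        refine norm_sum_le_of_le _ fun i _ => ?_
        rw [norm_smul, Real.norm_eq_abs]
        have := htr i
        have := hJ i
        have := hk i
        gcongr
    _ = (n : ℝ)⁻¹ * (n : ℝ)⁻¹ * B * ∑ i ∈ Finset.range n, k i * M i := by
        rw [Finset.mul_sum, Finset.mul_sum]
        exact Finset.sum_congr rfl fun i _ => by ring
    _ ≤ (n : ℝ)⁻¹ * (n : ℝ)⁻¹ * B * (D * n) := by gcongr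
    _ = _ := by field_simp

end Gram

/-! ### Multivariate central limit theorem and convergence in probability -/

section Limits

variable {Ω : Type*} [MeasurableSpace Ω] {μ : Measure Ω} [IsProbabilityMeasure μ] {p : ℕ}

/-- A multivariate central limit theorem for weighted sums of i.i.d. standardized variables. -/
theorem tendstoInDistribution_sum_smul_add {ε : ℕ → Ω → ℝ} (hm : ∀ i, Measurable (ε i))
    (hi : iIndepFun ε μ) (hid : ∀ i, IdentDistrib (ε i) (ε 0) μ μ)
    (h0 : ∫ ω, ε 0 ω ∂μ = 0) (h1 : ∫ ω, ε 0 ω ^ 2 ∂μ = 1)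
    {S : Matrix (Fin p) (Fin p) ℝ} (hS : S.PosSemidef) (m : Par p) {u : ℕ → ℕ → Par p}
    (hsq : ∀ t : Par p, Tendsto (fun n => ∑ i ∈ Finset.range n, inner ℝ (u n i) t ^ 2) atTop
      (𝓝 (t.ofLp ⬝ᵥ S.mulVec t.ofLp)))
    (hmax : ∀ η > 0, ∀ᶠ n in atTop, ∀ i < n, ‖u n i‖ ≤ η) :
    TendstoInDistribution (fun (n : ℕ) ω => ∑ i ∈ Finset.range n, ε i ω • u n i + m) atTop
      (id : Par p → Par p) (fun _ => μ) (multivariateGaussian m S) := by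
  have hmeas : ∀ n : ℕ, Measurable fun ω => ∑ i ∈ Finset.range n, ε i ω • u n i := fun n =>
    Finset.measurable_sum _ fun i _ => (hm i).smul_const _
  refine ⟨fun n => ((hmeas n).add_const m).aemeasurable, aemeasurable_id, ?_⟩
  refine ProbabilityMeasure.tendsto_of_tendsto_charFun fun t => ?_
  simp only [ProbabilityMeasure.coe_mk, Measure.map_id]
  have hcf : ∀ n : ℕ, charFun (μ.map fun ω => ∑ i ∈ Finset.range n, ε i ω • u n i + m) t =
      (∏ i ∈ Finset.range n, charFun (μ.map (ε 0)) (inner ℝ (u n i) t)) *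
        Complex.exp (inner ℝ m t * Complex.I) := by
    intro n
    rw [← charFun_map_sum_smul hm hi hid, charFun_apply, charFun_apply,
      integral_map ((hmeas n).add_const m).aemeasurable (by fun_prop),
      integral_map (hmeas n).aemeasurable (by fun_prop), ← integral_mul_const]
    refine integral_congr_ae (ae_of_all _ fun ω => ?_)
    simp only [inner_add_left]
    rw [← Complex.exp_add]
    push_cast
    ring_nf
  simp_rw [hcf]
  rw [charFun_multivariateGaussian hS]
  have hlim := tendsto_prod_charFun (μ := μ) (hm 0).aemeasurable h0 h1 (hsq t) (fun η hη => by
    filter_upwards [hmax (η / (‖t‖ + 1)) (by positivity)] with n hn i hin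
    calc |inner ℝ (u n i) t| ≤ ‖u n i‖ * ‖t‖ := abs_real_inner_le_norm _ _
      _ ≤ η / (‖t‖ + 1) * (‖t‖ + 1) := by
        gcongr
        · exact hn i hin
        · linarith
      _ = η := by field_simp)
  convert hlim.mul_const (Complex.exp (inner ℝ m t * Complex.I)) using 2
  rw [← Complex.exp_add, real_inner_comm]
  ring_nf

theorem tendstoInMeasure_zero_of_le {F F' : Type*} [SeminormedAddCommGroup F]
    [SeminormedAddCommGroup F'] {q : ℕ → Ω → F} {Z : ℕ → Ω → F'} {B : ℝ} {d : ℕ → ℝ} (hB : 0 ≤ B)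
    (hq : TendstoInMeasure μ q atTop 0) (hd : Tendsto d atTop (𝓝 0))
    (hZ : ∀ᶠ n in atTop, ∀ ω, ‖Z n ω‖ ≤ B * ‖q n ω‖ + d n) : TendstoInMeasure μ Z atTop 0 := by
  rw [tendstoInMeasure_iff_measureReal_norm] at *
  intro τ hτ
  refine squeeze_zero' (Eventually.of_forall fun n => measureReal_nonneg) ?_
    (hq (τ / 2 / (B + 1)) (by positivity))
  filter_upwards [hZ, hd.eventually_lt_const (half_pos hτ)] with n hn hdn
  refine measureReal_mono (fun ω hω => ?_) (measure_ne_top _ _)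
  simp only [Set.mem_ofPred_eq, Pi.zero_apply, sub_zero] at hω ⊢
  rw [div_le_iff₀ (by positivity)]
  have := hn ω
  have := norm_nonneg (q n ω)
  nlinarith

end Limits

/-! ### Linear expansion of a root -/

section RootExpansion

variable {E : Type*} [NormedAddCommGroup E] [NormedSpace ℝ E]

/-- A bootstrap. The Lipschitz bound on the fixed ball first yields `‖θ - θ₀‖ ≤ 2 L ‖F θ₀‖ = O(η)`;
applied again with that distance as radius, it has a constant of order `η`. Hence a root in the
fixed ball is automatically close to `θ₀`. -/
theorem norm_root_sub_le {F : E → E} {A T : E →L[ℝ] E} (hTA : ∀ v, T (A v) = v)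
    {L k b η r ρ : ℝ} (hT : ‖T‖ ≤ L) {θ₀ θ : E} (hη : 0 ≤ η) (hk : 0 ≤ k)
    (hF : ∀ r < ρ, ∀ θ ∈ Metric.closedBall θ₀ r, ∀ θ' ∈ Metric.closedBall θ₀ r,
      ‖F θ - F θ' + A (θ - θ')‖ ≤ k * (η + r) * ‖θ - θ'‖)
    (hr : r < ρ) (hθ : θ ∈ Metric.closedBall θ₀ r) (hroot : F θ = 0)
    (hκ : L * (k * (η + r)) ≤ 1 / 2) (hb : ‖F θ₀‖ ≤ b * η) :
    ‖θ - θ₀ - T (F θ₀)‖ ≤ 2 * L ^ 2 * k * (1 + 2 * L * b) * η * ‖F θ₀‖ := by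
  have hL : 0 ≤ L := (norm_nonneg T).trans hT
  have hr0 : 0 ≤ r := dist_nonneg.trans (Metric.mem_closedBall.1 hθ)
  set d := ‖θ - θ₀‖ with hd
  have hd0 : 0 ≤ d := norm_nonneg _
  have hmain : ∀ r' < ρ, d ≤ r' → ‖θ - θ₀ - T (F θ₀)‖ ≤ L * (k * (η + r')) * d := by
    intro r' hr' hdr
    have h := norm_sub_sub_le_of_lipschitz hTA hT (hF r' hr' θ (mem_closedBall_iff_norm.2 hdr) θ₀
      (Metric.mem_closedBall_self (hd0.trans hdr)))
    rw [hroot, zero_sub, map_neg] at h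
    calc _ = ‖-T (F θ₀) + (θ - θ₀)‖ := by congr 1; abel
      _ ≤ _ := h
  have hdr : d ≤ r := mem_closedBall_iff_norm.1 hθ
  have h1 := hmain r hr hdr
  have hTF : ‖T (F θ₀)‖ ≤ L * ‖F θ₀‖ := (T.le_opNorm _).trans (by gcongr)
  have h2 : d ≤ 2 * L * ‖F θ₀‖ := by
    have e : d ≤ ‖θ - θ₀ - T (F θ₀)‖ + ‖T (F θ₀)‖ := by
      calc d = ‖(θ - θ₀ - T (F θ₀)) + T (F θ₀)‖ := by rw [sub_add_cancel]
        _ ≤ _ := norm_add_le _ _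
    have : L * (k * (η + r)) * d ≤ 1 / 2 * d := by gcongr
    linarith
  have h3 : d ≤ 2 * L * b * η := by
    calc d ≤ 2 * L * ‖F θ₀‖ := h2
      _ ≤ 2 * L * (b * η) := by gcongr
      _ = _ := by ring
  calc _ ≤ L * (k * (η + d)) * d := hmain d (hdr.trans_lt hr) le_rfl
    _ ≤ L * (k * (η + 2 * L * b * η)) * (2 * L * ‖F θ₀‖) := by
      have : 0 ≤ L * (k * (η + 2 * L * b * η)) := by
        have : 0 ≤ 2 * L * b * η := hd0.trans h3
        positivity
      gcongr
    _ = _ := by ring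

end RootExpansion

/-! ### Covariance of the linear part -/

section Main

variable {X Ω : Type*} [MeasurableSpace Ω] {μ : Measure Ω} [IsProbabilityMeasure μ] {p : ℕ}
  {f : X → Par p → ℝ} {x : ℕ → X} {θ₀ : Par p}

/-- With `B = (JᵀJ/n)⁻¹` symmetric, the sum is `tᵀ B (JᵀJ/n) B t = tᵀ B t`. -/
theorem tendsto_sum_inner_sq
    (hgram : ∀ᶠ n in atTop, IsUnit (gram f x θ₀ n).det) {S : Matrix (Fin p) (Fin p) ℝ}
    (hS : Tendsto (fun n : ℕ => ((n : ℝ)⁻¹ • gram f x θ₀ n)⁻¹) atTop (𝓝 S)) (t : Par p) :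
    Tendsto (fun n : ℕ => ∑ i ∈ Finset.range n, inner ℝ ((√(n : ℝ))⁻¹ •
      Matrix.toEuclideanCLM (n := Fin p) (𝕜 := ℝ) ((n : ℝ)⁻¹ • gram f x θ₀ n)⁻¹
        (relGrad f x θ₀ i)) t ^ 2) atTop (𝓝 (t.ofLp ⬝ᵥ S.mulVec t.ofLp)) := by
  have hc : Continuous fun B : Matrix (Fin p) (Fin p) ℝ => t.ofLp ⬝ᵥ B.mulVec t.ofLp := by fun_prop
  refine ((hc.tendsto S).comp hS).congr' ?_
  filter_upwards [hgram, eventually_gt_atTop 0] with n hg hn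
  set B := ((n : ℝ)⁻¹ • gram f x θ₀ n)⁻¹ with hB
  have hsymm : ∀ v w : Par p, inner ℝ (Matrix.toEuclideanCLM (n := Fin p) (𝕜 := ℝ) B v) w =
      inner ℝ v (Matrix.toEuclideanCLM (n := Fin p) (𝕜 := ℝ) B w) := by
    intro v w
    have hBs : B.transpose = B := by
      have := (posSemidef_inv_gram (f := f) (x := x) (θ₀ := θ₀) n).1
      rwa [Matrix.isHermitian_iff_isSymm] at this
    rw [real_inner_comm, Matrix.inner_toEuclideanCLM, Matrix.inner_toEuclideanCLM,
      Matrix.dotProduct_mulVec, ← Matrix.mulVec_transpose, hBs, dotProduct_comm]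
  have hAB : Matrix.toEuclideanCLM (n := Fin p) (𝕜 := ℝ) ((n : ℝ)⁻¹ • gram f x θ₀ n)
      (Matrix.toEuclideanCLM (n := Fin p) (𝕜 := ℝ) B t) = t := by
    rw [← mul_apply_eq_comp, ← map_mul, hB,
      Matrix.mul_nonsing_inv _ (isUnit_det_smul_gram hn hg), map_one]
    rfl
  set w := Matrix.toEuclideanCLM (n := Fin p) (𝕜 := ℝ) B t with hw
  have hn' : 0 ≤ (n : ℝ) := Nat.cast_nonneg n
  rw [toEuclideanCLM_gram] at hAB
  calc t.ofLp ⬝ᵥ B.mulVec t.ofLp = inner ℝ t w := by rw [hw, Matrix.inner_toEuclideanCLM]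
    _ = inner ℝ ((n : ℝ)⁻¹ • ∑ i ∈ Finset.range n, inner ℝ (relGrad f x θ₀ i) w •
          relGrad f x θ₀ i) w := by rw [hAB]
    _ = _ := by
      rw [real_inner_smul_left, sum_inner, Finset.mul_sum]
      refine Finset.sum_congr rfl fun i _ => ?_
      rw [real_inner_smul_left, real_inner_smul_left, hsymm, mul_pow, inv_pow, Real.sq_sqrt hn']
      ring

end Main

/-! ### Remainder bounds and the limit law for a general kernel -/

section Main

variable {X Ω : Type*} [MeasurableSpace Ω] {μ : Measure Ω} [IsProbabilityMeasure μ] {p : ℕ}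
  {f : X → Par p → ℝ} {x : ℕ → X} {θ₀ : Par p}

theorem tendstoInMeasure_quadratic_part {ε : ℕ → Ω → ℝ} (hm : ∀ i, Measurable (ε i))
    (hi : iIndepFun ε μ) (hid : ∀ i, IdentDistrib (ε i) (ε 0) μ μ) (hL2 : MemLp (ε 0) 2 μ)
    (h1 : ∫ ω, ε 0 ω ^ 2 ∂μ = 1) {J : ℕ → Par p} {C : ℝ}
    (hJ1 : ∀ᶠ n : ℕ in atTop, ∑ i ∈ Finset.range n, ‖J i‖ ≤ C * n)
    (hJ2 : ∀ᶠ n : ℕ in atTop, ∑ i ∈ Finset.range n, ‖J i‖ ^ 2 ≤ C * n) {Γ : Par p}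
    (hΓ : Tendsto (fun n : ℕ => (n : ℝ)⁻¹ • ∑ i ∈ Finset.range n, J i) atTop (𝓝 Γ))
    {T : ℕ → Par p →L[ℝ] Par p} {T₀ : Par p →L[ℝ] Par p} (hT : Tendsto T atTop (𝓝 T₀))
    {k : ℕ → ℝ} {k₀ : ℝ} (hk : Tendsto k atTop (𝓝 k₀)) :
    TendstoInMeasure μ (fun (n : ℕ) ω =>
      k n • T n ((n : ℝ)⁻¹ • ∑ i ∈ Finset.range n, ε i ω ^ 2 • J i) - k₀ • T₀ Γ) atTop 0 := by
  have hq := tendstoInMeasure_weighted_mean (μ := μ) (W := fun i ω => ε i ω ^ 2)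
    (fun i => (hm i).pow_const 2) (hi.comp (fun _ r => r ^ 2) fun _ => measurable_id.pow_const 2)
    (fun i => (hid i).comp (u := fun r => r ^ 2) (by fun_prop)) hL2.integrable_sq
    (fun i ω => sq_nonneg _) hJ1 hJ2
  have hdet : Tendsto (fun n : ℕ => k n • T n ((n : ℝ)⁻¹ • ∑ i ∈ Finset.range n, J i) - k₀ • T₀ Γ)
      atTop (𝓝 0) := by
    have happ := (isBoundedBilinearMap_apply (𝕜 := ℝ) (E := Par p) (F := Par p)).continuous.tendsto
      (T₀, Γ) |>.comp (hT.prodMk_nhds hΓ)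
    have := (hk.smul happ).sub_const (k₀ • T₀ Γ)
    rwa [sub_self] at this
  refine tendstoInMeasure_zero_of_le (B := (|k₀| + 1) * (‖T₀‖ + 1)) (by positivity) hq
    (tendsto_zero_iff_norm_tendsto_zero.1 hdet) ?_
  filter_upwards [hk.abs.eventually_lt_const (lt_add_one |k₀|),
    hT.norm.eventually_lt_const (lt_add_one ‖T₀‖)] with n hkn hTn ω
  have e : k n • T n ((n : ℝ)⁻¹ • ∑ i ∈ Finset.range n, ε i ω ^ 2 • J i) - k₀ • T₀ Γ =
      k n • T n ((n : ℝ)⁻¹ • ∑ i ∈ Finset.range n, (ε i ω ^ 2 - ∫ ω, ε 0 ω ^ 2 ∂μ) • J i) +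
      (k n • T n ((n : ℝ)⁻¹ • ∑ i ∈ Finset.range n, J i) - k₀ • T₀ Γ) := by
    rw [h1, ← add_sub_assoc, ← smul_add, ← map_add, ← smul_add, ← Finset.sum_add_distrib]
    simp [sub_smul]
  rw [e]
  refine (norm_add_le _ _).trans ?_
  gcongr
  rw [norm_smul, Real.norm_eq_abs, mul_assoc]
  gcongr
  exact (ContinuousLinearMap.le_opNorm _ _).trans (by gcongr)

/-- Transfers a root expansion in terms of the exact scaled score `U` to its quadratic approximation
`V`, keeping the factor `η` in front. -/
theorem norm_sub_map_le {E : Type*} [NormedAddCommGroup E] [NormedSpace ℝ E] {T : E →L[ℝ] E}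
    {L C D η Q : ℝ} (hT : ‖T‖ ≤ L) (hC : 0 ≤ C) (hD : 0 ≤ D) (hη : 0 ≤ η) (hη1 : η ≤ 1)
    (hQ : 0 ≤ Q) {U V z : E} (hU : ‖U - V‖ ≤ C * η * Q) (hz : ‖z - T U‖ ≤ D * η * ‖U‖) :
    ‖z - T V‖ ≤ (D + D * C + L * C) * η * (‖V‖ + Q) := by
  have hL : 0 ≤ L := (norm_nonneg T).trans hT
  have hUn : ‖U‖ ≤ ‖V‖ + C * η * Q := by
    calc _ = ‖V + (U - V)‖ := by rw [add_sub_cancel]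
      _ ≤ _ := (norm_add_le _ _).trans (by gcongr)
  have hTd : ‖T (U - V)‖ ≤ L * (C * η * Q) := (T.le_opNorm _).trans (by gcongr)
  calc ‖z - T V‖ = ‖(z - T U) + T (U - V)‖ := by rw [map_sub, sub_add_sub_cancel]
    _ ≤ D * η * ‖U‖ + L * (C * η * Q) := (norm_add_le _ _).trans (add_le_add hz hTd)
    _ ≤ D * η * (‖V‖ + C * 1 * Q) + L * (C * η * Q) := by
        gcongr
        exact hUn.trans (by gcongr)
    _ = η * (D * ‖V‖ + (D * C + L * C) * Q) := by ring
    _ ≤ η * ((D + D * C + L * C) * ‖V‖ + (D + D * C + L * C) * Q) := by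
        have : 0 ≤ L * C := by positivity
        have : 0 ≤ D * C := by positivity
        gcongr <;> linarith
    _ = _ := by ring

theorem le_one_add_sq (y : ℝ) : y ≤ 1 + y ^ 2 := by nlinarith [sq_nonneg (y - 1)]

/-- This envelope will dominate the scaled quadratic score and its remainder. By independence and
centring the squared norm has expectation `∑ ‖J i‖²`, so the mean of the envelope stays bounded in
`n` when `w` does. -/
theorem integral_envelope_le {E : Type*} [NormedAddCommGroup E] [InnerProductSpace ℝ E]
    {ε : ℕ → Ω → ℝ} (hi : iIndepFun ε μ)
    (hid : ∀ i, IdentDistrib (ε i) (ε 0) μ μ) (hL2 : MemLp (ε 0) 2 μ)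
    (h0 : ∫ ω, ε 0 ω ∂μ = 0) (h1 : ∫ ω, ε 0 ω ^ 2 ∂μ = 1) {n : ℕ} (hn : 0 < n)
    {J : ℕ → E} {M : ℕ → ℝ} {B w : ℝ} (hw : 0 ≤ w) (hM0 : ∀ i, 0 ≤ M i)
    (hJ : ∑ i ∈ Finset.range n, ‖J i‖ ^ 2 ≤ B * n) (hM : ∑ i ∈ Finset.range n, M i ≤ B * n) :
    Integrable (fun ω => 1 + (n : ℝ)⁻¹ * ‖∑ i ∈ Finset.range n, ε i ω • J i‖ ^ 2 +
      w * ((n : ℝ)⁻¹ * ∑ i ∈ Finset.range n, ε i ω ^ 2 * M i)) μ ∧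
    (∀ ω, 0 ≤ 1 + (n : ℝ)⁻¹ * ‖∑ i ∈ Finset.range n, ε i ω • J i‖ ^ 2 +
      w * ((n : ℝ)⁻¹ * ∑ i ∈ Finset.range n, ε i ω ^ 2 * M i)) ∧
    ∫ ω, (1 + (n : ℝ)⁻¹ * ‖∑ i ∈ Finset.range n, ε i ω • J i‖ ^ 2 +
      w * ((n : ℝ)⁻¹ * ∑ i ∈ Finset.range n, ε i ω ^ 2 * M i)) ∂μ ≤ 1 + B + w * B := by
  have hn' : (0 : ℝ) < n := by exact_mod_cast hn
  have hLi : ∀ i, MemLp (ε i) 2 μ := fun i => (hid i).memLp_iff.2 hL2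
  have h0i : ∀ i, ∫ ω, ε i ω ∂μ = 0 := fun i => (hid i).integral_eq.trans h0
  have h1i : ∀ i, ∫ ω, ε i ω ^ 2 ∂μ = 1 := fun i =>
    ((hid i).comp (u := fun s => s ^ 2) (by fun_prop)).integral_eq.trans h1
  have hsq := integral_norm_sum_smul_sq hLi hi h0i h1i n J
  have hI1 : Integrable (fun ω => (n : ℝ)⁻¹ * ‖∑ i ∈ Finset.range n, ε i ω • J i‖ ^ 2) μ :=
    hsq.1.const_mul _
  have hI2 : Integrable (fun ω => ∑ i ∈ Finset.range n, ε i ω ^ 2 * M i) μ :=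
    integrable_finsetSum _ fun i _ => ((hLi i).integrable_sq).mul_const _
  have hI3 : Integrable (fun ω => w * ((n : ℝ)⁻¹ *
      ∑ i ∈ Finset.range n, ε i ω ^ 2 * M i)) μ := (hI2.const_mul _).const_mul _
  have hI4 : Integrable (fun ω => 1 + (n : ℝ)⁻¹ *
      ‖∑ i ∈ Finset.range n, ε i ω • J i‖ ^ 2) μ := (integrable_const _).add hI1
  refine ⟨hI4.add hI3, fun ω => ?_, ?_⟩
  · have : 0 ≤ ∑ i ∈ Finset.range n, ε i ω ^ 2 * M i :=
      Finset.sum_nonneg fun i _ => mul_nonneg (sq_nonneg _) (hM0 i)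
    positivity
  rw [integral_add hI4 hI3, integral_add (integrable_const _) hI1,
    integral_const_mul, integral_const_mul, integral_const_mul, hsq.2,
    integral_finsetSum _ fun i _ => ((hLi i).integrable_sq).mul_const _]
  simp_rw [integral_mul_const, h1i]
  simp only [integral_const, probReal_univ, smul_eq_mul, one_mul]
  gcongr
  · rw [inv_mul_le_iff₀ hn']
    linarith
  · rw [inv_mul_le_iff₀ hn']
    linarith

-- The probabilistic and the deterministic estimates meet here. The kernel enters the limit only
-- through `a`, so this one statement serves both estimators.
set_option maxHeartbeats 1000000 in
theorem rootsTendToMVN_of_kernel {ε : ℕ → Ω → ℝ} (hm : ∀ i, Measurable (ε i))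
    (hi : iIndepFun ε μ) (hid : ∀ i, IdentDistrib (ε i) (ε 0) μ μ) (hL2 : MemLp (ε 0) 2 μ)
    (h0 : ∫ ω, ε 0 ω ∂μ = 0) (h1 : ∫ ω, ε 0 ω ^ 2 ∂μ = 1)
    {ρ c : ℝ} {M N : ℕ → ℝ} {K : ℝ}
    (hmod : LocalModel (relMean f x θ₀) (relGradAt f x θ₀) θ₀ ρ c M N K)
    {φ : ℝ → ℝ → ℝ} {a C : ℝ} (hφ : ScoreKernel φ a c C)
    {σ : ℕ → ℝ} (hσ : ∀ n, 0 < σ n) {δ : ℝ}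
    (hδ : Tendsto (fun n : ℕ => √(n : ℝ) * σ n) atTop (𝓝 δ))
    {S : Matrix (Fin p) (Fin p) ℝ} {Γ₁ : Par p}
    (hgram : ∀ᶠ n in atTop, IsUnit (gram f x θ₀ n).det)
    (hS : Tendsto (fun n : ℕ => ((n : ℝ)⁻¹ • gram f x θ₀ n)⁻¹) atTop (𝓝 S))
    (hΓ₁ : Tendsto (fun n : ℕ => (n : ℝ)⁻¹ •
      ∑ i ∈ Finset.range n, relGrad f x θ₀ i) atTop (𝓝 Γ₁))
    {Ψ : ℕ → Ω → Par p → Par p}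
    (hΨ : ∀ n ω, ∀ θ ∈ Metric.ball θ₀ ρ, Ψ n ω θ = ∑ i ∈ Finset.range n,
      φ (σ n * ε i ω) (relMean f x θ₀ i θ) • relGradAt f x θ₀ i θ) :
    RootsTendToMVN μ Ψ θ₀ σ
      (δ • Matrix.toEuclideanCLM (n := Fin p) (𝕜 := ℝ) S (a • Γ₁)) S := by
  have hC := hφ.nonneg
  have hK := hmod.K_nonneg
  have hρ := hmod.hρ
  set T : ℕ → Par p →L[ℝ] Par p := fun n =>
    Matrix.toEuclideanCLM (n := Fin p) (𝕜 := ℝ) ((n : ℝ)⁻¹ • gram f x θ₀ n)⁻¹ with hTdef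
  set A : ℕ → Par p →L[ℝ] Par p := fun n =>
    Matrix.toEuclideanCLM (n := Fin p) (𝕜 := ℝ) ((n : ℝ)⁻¹ • gram f x θ₀ n) with hAdef
  set T₀ := Matrix.toEuclideanCLM (n := Fin p) (𝕜 := ℝ) S with hT₀
  have hTlim : Tendsto T atTop (𝓝 T₀) := by
    have hc : Continuous fun B : Matrix (Fin p) (Fin p) ℝ =>
        Matrix.toEuclideanCLM (n := Fin p) (𝕜 := ℝ) B :=
      LinearMap.continuous_of_finiteDimensional
        (IsLinearMap.mk' (Matrix.toEuclideanCLM (n := Fin p) (𝕜 := ℝ))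
          ⟨fun _ _ => map_add _ _ _, fun _ _ => map_smul _ _ _⟩)
    exact (hc.tendsto S).comp hS
  have hTA : ∀ᶠ n in atTop, (∀ v, T n (A n v) = v) ∧ ∀ v, A n (T n v) = v := by
    filter_upwards [hgram, eventually_gt_atTop 0] with n hg hn
    have hu := isUnit_det_smul_gram hn hg
    constructor <;> intro v <;> simp only [hTdef, hAdef] <;>
      rw [← mul_apply_eq_comp, ← map_mul]
    · rw [Matrix.nonsing_inv_mul _ hu, map_one]; rfl
    · rw [Matrix.mul_nonsing_inv _ hu, map_one]; rfl
  set L := ‖T₀‖ + 1 with hLdef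
  have hL : 0 < L := by positivity
  have hTL : ∀ᶠ n in atTop, ‖T n‖ ≤ L :=
    (hTlim.norm.eventually_lt_const (lt_add_one _)).mono fun _ => le_of_lt
  set k := (C + 2) * (3 * K + 1) with hk
  have hk0 : 0 < k := by positivity
  set b := C * (1 + K) with hb
  have hb0 : 0 ≤ b := by positivity
  -- Chosen so that `L k (η + r) ≤ 1 / 2` for every `η ≤ r`, which is the contraction condition; it
  -- depends neither on `n` nor on the noise.
  set r := min (ρ / 2) (1 / (4 * L * k)) with hr
  have hr0 : 0 < r := by positivity
  have hrρ : r < ρ := (min_le_left _ _).trans_lt (by linarith)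
  have hLkr : L * (k * (r + r)) ≤ 1 / 2 := by
    have : r ≤ 1 / (4 * L * k) := min_le_right _ _
    rw [le_div_iff₀ (by positivity)] at this
    linarith
  set F : ℕ → Ω → Par p → Par p := fun n ω θ => (n : ℝ)⁻¹ • ∑ i ∈ Finset.range n,
    φ (σ n * ε i ω) (relMean f x θ₀ i θ) • relGradAt f x θ₀ i θ with hFdef
  have hFlip : ∀ᶠ n : ℕ in atTop, ∀ (ω : Ω) (η : ℝ), (∀ i < n, |σ n * ε i ω| ≤ η) → 0 ≤ η →
      η ≤ 1 / 2 → ∀ r < ρ, ∀ θ ∈ Metric.closedBall θ₀ r, ∀ θ' ∈ Metric.closedBall θ₀ r,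
      ‖F n ω θ - F n ω θ' + A n (θ - θ')‖ ≤ k * (η + r) * ‖θ - θ'‖ := by
    filter_upwards [hmod.score_lip hφ, eventually_gt_atTop 0] with n hn hn0 ω η hs hη0 hη r hr
      θ hθ θ' hθ'
    have hn' : (0 : ℝ) < n := by exact_mod_cast hn0
    simp only [hFdef, hAdef]
    rw [toEuclideanCLM_gram, ← smul_sub, ← smul_add, norm_smul, norm_inv, Real.norm_natCast,
      inv_mul_le_iff₀ hn']
    exact hn _ η r hs hη0 hη hr θ hθ θ' hθ'
  have hFc : ∀ᶠ n : ℕ in atTop, ∀ (ω : Ω) (η : ℝ), (∀ i < n, |σ n * ε i ω| ≤ η) → 0 ≤ η →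
      η ≤ 1 / 2 → ‖F n ω θ₀‖ ≤ b * η := by
    filter_upwards [hmod.score_center_le hφ, eventually_gt_atTop 0] with n hn hn0 ω η hs hη0 hη
    have hn' : (0 : ℝ) < n := by exact_mod_cast hn0
    simp only [hFdef]
    rw [norm_smul, norm_inv, Real.norm_natCast, inv_mul_le_iff₀ hn']
    exact hn _ η hs hη0 hη
  have hFΨ : ∀ n : ℕ, 0 < n → ∀ ω, ∀ θ ∈ Metric.ball θ₀ r, (F n ω θ = 0 ↔ Ψ n ω θ = 0) := by
    intro n hn ω θ hθ
    rw [hΨ n ω θ (Metric.ball_subset_ball hrρ.le hθ)]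
    simp only [hFdef]
    rw [smul_eq_zero_iff_right (inv_ne_zero (Nat.cast_ne_zero.2 hn.ne'))]
  refine ⟨r, hr0, ?_, fun θhat hθm hθhat => ?_⟩
  -- The last bound gives `L b η ≤ r / 4`, the smallness of the score at the centre required for
  -- existence.
  · set η := min (1 / 2) (min r (r / (4 * L * (b + 1)))) with hη
    have hη0 : 0 < η := by positivity
    have hη2 : η ≤ 1 / 2 := min_le_left _ _
    have hηr : η ≤ r := (min_le_right _ _).trans (min_le_left _ _)
    have hηb : L * (b * η) ≤ r / 4 := by
      have : η ≤ r / (4 * L * (b + 1)) := (min_le_right _ _).trans (min_le_right _ _)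
      rw [le_div_iff₀ (by positivity)] at this
      have : 0 ≤ L * η := by positivity
      linarith
    have hbad := tendsto_measure_exists_gt hm hid hL2 hδ hη0
    have hbad' : Tendsto (fun n => μ {ω | ¬ ∀ i < n, |σ n * ε i ω| ≤ η}) atTop (𝓝 0) :=
      (ENNReal.tendsto_toReal_iff (fun _ => measure_ne_top _ _) ENNReal.zero_ne_top).1 hbad
    refine tendsto_of_tendsto_of_tendsto_of_le_of_le' tendsto_const_nhds hbad'
      (Eventually.of_forall fun _ => zero_le) ?_
    filter_upwards [hTA, hTL, hFlip, hFc, eventually_gt_atTop 0] with n hTAn hTLn hlip hcen hn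
    refine measure_mono fun ω hω => ?_
    simp only [Set.mem_ofPred_eq] at hω ⊢
    intro hs
    refine hω ?_
    have hex := existsUnique_root (F := F n ω) (θ₀ := θ₀) hTAn.1 hTAn.2 hTLn hr0
      (hlip ω η hs hη0.le hη2 r hrρ)
      ((by gcongr : L * (k * (η + r)) ≤ L * (k * (r + r))).trans hLkr)
      ((by gcongr; exact hcen ω η hs hη0.le hη2 : L * ‖F n ω θ₀‖ ≤ L * (b * η)).trans hηb)
    obtain ⟨θ, ⟨hθ, hFθ⟩, huniq⟩ := hex
    exact ⟨θ, ⟨hθ, (hFΨ n hn ω θ hθ).1 hFθ⟩,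
      fun θ' h => huniq θ' ⟨h.1, (hFΨ n hn ω θ' h.1).2 h.2⟩⟩
  · set m := δ • T₀ (a • Γ₁) with hmdef
    set u : ℕ → ℕ → Par p := fun n i => (√(n : ℝ))⁻¹ • T n (relGrad f x θ₀ i) with hu
    have hJM : ∀ i, ‖relGrad f x θ₀ i‖ ≤ M i := hmod.norm_center_le
    have hX := tendstoInDistribution_sum_smul_add hm hi hid h0 h1
      (posSemidef_of_tendsto hS posSemidef_inv_gram) m (u := u)
      (fun t => tendsto_sum_inner_sq hgram hS t) (fun η hη => by
        filter_upwards [hTL, hmod.eventually_le_sqrt (div_pos hη hL), eventually_gt_atTop 0]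
          with n hn hM hn0 i hin
        have hs : 0 < √(n : ℝ) := Real.sqrt_pos.2 (by exact_mod_cast hn0)
        simp only [hu]
        rw [norm_smul, norm_inv, Real.norm_eq_abs, abs_of_pos hs, inv_mul_le_iff₀ hs]
        calc ‖T n (relGrad f x θ₀ i)‖ ≤ ‖T n‖ * ‖relGrad f x θ₀ i‖ := (T n).le_opNorm _
          _ ≤ L * (η / L * √(n : ℝ)) := by
            gcongr
            exact (hJM i).trans (hM i hin)
          _ = _ := by field_simp)
    -- Slutsky's argument: it remains to compare the scaled estimator with the Gaussian sum, passing
    -- through the quadratic approximation `T n (V n ω)`.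
    refine tendstoInDistribution_of_tendstoInMeasure_sub _ _ hX ?_
      (fun n => ((hθm n).sub_const θ₀).const_smul (√(n : ℝ) / σ n))
    have hJ1 : ∀ᶠ n : ℕ in atTop, ∑ i ∈ Finset.range n, ‖relGrad f x θ₀ i‖ ≤ (1 + K) * n :=
      hmod.sum_M_one.mono fun n hn => (Finset.sum_le_sum fun i _ => hJM i).trans hn
    have hJ2 : ∀ᶠ n : ℕ in atTop, ∑ i ∈ Finset.range n, ‖relGrad f x θ₀ i‖ ^ 2 ≤ (1 + K) * n :=
      hmod.sum_M_sq.mono fun n hn => (Finset.sum_le_sum fun i _ => by gcongr; exact hJM i).trans hn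
    have hquad := tendstoInMeasure_quadratic_part hm hi hid hL2 h1 hJ1 hJ2 hΓ₁ hTlim
      (hδ.const_mul a)
    set V : ℕ → Ω → Par p := fun n ω => (√(n : ℝ) / σ n) • (n : ℝ)⁻¹ • ∑ i ∈ Finset.range n,
      (σ n * ε i ω + a * (σ n * ε i ω) ^ 2) • relGrad f x θ₀ i with hV
    have hVeq : ∀ n : ℕ, 0 < n → ∀ ω, V n ω = (√(n : ℝ))⁻¹ • ∑ i ∈ Finset.range n,
        ε i ω • relGrad f x θ₀ i + (a * (√(n : ℝ) * σ n)) •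
          ((n : ℝ)⁻¹ • ∑ i ∈ Finset.range n, ε i ω ^ 2 • relGrad f x θ₀ i) := by
      intro n hn ω
      have hs : 0 < √(n : ℝ) := Real.sqrt_pos.2 (by exact_mod_cast hn)
      have hsn : (n : ℝ) = √(n : ℝ) ^ 2 := (Real.sq_sqrt (Nat.cast_nonneg n)).symm
      have hσn := hσ n
      simp only [hV]
      rw [smul_smul, smul_smul, Finset.smul_sum, Finset.smul_sum, Finset.smul_sum,
        ← Finset.sum_add_distrib]
      refine Finset.sum_congr rfl fun i _ => ?_
      rw [smul_smul, smul_smul, smul_smul, ← add_smul]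
      congr 1
      generalize √(n : ℝ) = q at hs hsn
      rw [hsn]
      field_simp
    have hTV : TendstoInMeasure μ
        (fun n ω => T n (V n ω) - (∑ i ∈ Finset.range n, ε i ω • u n i + m)) atTop 0 := by
      refine hquad.congr' ?_ EventuallyEq.rfl
      filter_upwards [eventually_gt_atTop 0] with n hn
      refine ae_of_all _ fun ω => ?_
      have e : T n ((√(n : ℝ))⁻¹ • ∑ i ∈ Finset.range n, ε i ω • relGrad f x θ₀ i) =
          ∑ i ∈ Finset.range n, ε i ω • u n i := by
        rw [map_smul, map_sum, Finset.smul_sum]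
        refine Finset.sum_congr rfl fun i _ => ?_
        rw [map_smul, smul_comm]
      have e2 : m = (a * δ) • T₀ Γ₁ := by
        rw [hmdef, map_smul, smul_smul, mul_comm]
      simp only
      rw [hVeq n hn ω, map_add, e, map_smul (T n) (a * _), e2]
      abel
    have hrem : TendstoInMeasure μ
        (fun (n : ℕ) ω => (√(n : ℝ) / σ n) • (θhat n ω - θ₀) - T n (V n ω)) atTop 0 := by
      set C₅ := 2 * L ^ 2 * k * (1 + 2 * L * b) with hC₅
      have hC₅0 : 0 ≤ C₅ := by positivity
      set C₃ := C₅ + C₅ * C + L * C with hC₃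
      have hC₃0 : 0 ≤ C₃ := by positivity
      set D := 1 + (1 + K) + (|a| + 1) * ((|δ| + 1) * (1 + K)) with hD
      have hD0 : 0 ≤ D := by positivity
      refine tendstoInMeasure_zero_of_bound fun κ hκ => ?_
      -- The remainder will be at most `C₃ η` times an envelope of mean at most `D`, so this choice
      -- makes its integral at most `κ`.
      set η := min (min (1 / 2) r) (κ / (C₃ * D + 1)) with hη
      have hη0 : 0 < η := by positivity
      have hη2 : η ≤ 1 / 2 := (min_le_left _ _).trans (min_le_left _ _)
      have hηr : η ≤ r := (min_le_left _ _).trans (min_le_right _ _)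
      have hηκ : C₃ * η * D ≤ κ := by
        have : η ≤ κ / (C₃ * D + 1) := min_le_right _ _
        rw [le_div_iff₀ (by positivity)] at this
        linarith only [this, hη0]
      -- The exceptional event: some noise term is too large, or the estimator is not a root in the
      -- ball.
      refine ⟨fun n => {ω | ¬ ∀ i < n, |σ n * ε i ω| ≤ η} ∪
        {ω | ¬ (θhat n ω ∈ Metric.ball θ₀ r ∧ Ψ n ω (θhat n ω) = 0)}, ?_, ?_⟩
      · have hA := tendsto_measure_exists_gt hm hid hL2 hδ hη0
        have hB := (ENNReal.tendsto_toReal_iff (fun _ => measure_ne_top _ _)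
          ENNReal.zero_ne_top).2 hθhat
        refine squeeze_zero (fun _ => measureReal_nonneg) (fun n => measureReal_union_le _ _) ?_
        have hAB := hA.add hB
        rwa [ENNReal.toReal_zero, _root_.add_zero] at hAB
      filter_upwards [hTA, hTL, hFlip, hFc, eventually_gt_atTop 0, hJ2, hmod.sum_M_one,
        hδ.abs.eventually_lt_const (lt_add_one |δ|)] with n hTAn hTLn hlip hcen hn hJ2n hM1n hδn
      have hn' : (0 : ℝ) < n := by exact_mod_cast hn
      have hs : 0 < √(n : ℝ) := Real.sqrt_pos.2 hn'
      have hσn := hσ n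
      have hsn : √(n : ℝ) ^ 2 = n := Real.sq_sqrt (Nat.cast_nonneg n)
      rw [abs_of_pos (mul_pos hs hσn)] at hδn
      have henv := integral_envelope_le hi hid hL2 h0 h1 hn (J := fun i => relGrad f x θ₀ i)
        (mul_nonneg (by positivity : 0 ≤ |a| + 1) (mul_pos hs hσn).le) hmod.hM hJ2n hM1n
      have hQ0 : ∀ ω, 0 ≤ ∑ i ∈ Finset.range n, ε i ω ^ 2 * M i := fun ω =>
        Finset.sum_nonneg fun i _ => mul_nonneg (sq_nonneg _) (hmod.hM i)
      refine ⟨fun ω => C₃ * η * (1 + (n : ℝ)⁻¹ *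
        ‖∑ i ∈ Finset.range n, ε i ω • relGrad f x θ₀ i‖ ^ 2 +
        (|a| + 1) * (√(n : ℝ) * σ n) * ((n : ℝ)⁻¹ * ∑ i ∈ Finset.range n, ε i ω ^ 2 * M i)),
        henv.1.const_mul _, fun ω => ?_, ?_, fun ω hω => ?_⟩
      · exact mul_nonneg (mul_nonneg hC₃0 hη0.le) (henv.2.1 ω)
      · rw [integral_const_mul]
        refine le_trans ?_ hηκ
        gcongr
        refine henv.2.2.trans ?_
        rw [hD, mul_assoc (|a| + 1)]
        gcongr
      · simp only [Set.mem_union, Set.mem_ofPred_eq, not_or, not_not] at hω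
        obtain ⟨hsm, hball, hroot⟩ := hω
        have hκ' : L * (k * (η + r)) ≤ 1 / 2 :=
          (by gcongr : L * (k * (η + r)) ≤ L * (k * (r + r))).trans hLkr
        have hexp := norm_root_sub_le hTAn.1 hTLn hη0.le hk0.le (hlip ω η hsm hη0.le hη2) hrρ
          (Metric.ball_subset_closedBall hball) ((hFΨ n hn ω _ hball).2 hroot) hκ'
          (hcen ω η hsm hη0.le hη2)
        set q := √(n : ℝ) / σ n with hq
        have hq0 : 0 < q := div_pos hs hσn
        set Q := √(n : ℝ) * σ n * ((n : ℝ)⁻¹ * ∑ i ∈ Finset.range n, ε i ω ^ 2 * M i) with hQ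
        have hQnn : 0 ≤ Q :=
          mul_nonneg (mul_pos hs hσn).le (mul_nonneg (inv_pos.2 hn').le (hQ0 ω))
        have hUV : ‖q • F n ω θ₀ - V n ω‖ ≤ C * η * Q := by
          have := hmod.score_center_expand hφ hsm hη2
          simp only [hFdef, hV]
          rw [← smul_sub, ← smul_sub, norm_smul, norm_smul, Real.norm_eq_abs, abs_of_pos hq0,
            norm_inv, Real.norm_natCast]
          calc _ ≤ q * ((n : ℝ)⁻¹ *
                (C * η * ∑ i ∈ Finset.range n, (σ n * ε i ω) ^ 2 * M i)) := by
                gcongr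
                exact this
            _ = C * η * Q := by
              have e : ∑ i ∈ Finset.range n, (σ n * ε i ω) ^ 2 * M i =
                  σ n ^ 2 * ∑ i ∈ Finset.range n, ε i ω ^ 2 * M i := by
                rw [Finset.mul_sum]
                exact Finset.sum_congr rfl fun i _ => by ring
              rw [e, hQ, hq]
              field_simp
        have hVn : ‖V n ω‖ ≤ 1 + (n : ℝ)⁻¹ *
            ‖∑ i ∈ Finset.range n, ε i ω • relGrad f x θ₀ i‖ ^ 2 + |a| * Q := by
          rw [hVeq n hn ω]
          refine (norm_add_le _ _).trans (add_le_add ?_ ?_)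
          · rw [norm_smul, norm_inv, Real.norm_eq_abs, abs_of_pos hs]
            set y := (√(n : ℝ))⁻¹ * ‖∑ i ∈ Finset.range n, ε i ω • relGrad f x θ₀ i‖ with hy
            have e : (n : ℝ)⁻¹ * ‖∑ i ∈ Finset.range n, ε i ω • relGrad f x θ₀ i‖ ^ 2 = y ^ 2 := by
              rw [hy, mul_pow, inv_pow, hsn]
            rw [e]
            exact le_one_add_sq y
          · rw [norm_smul, norm_smul, Real.norm_eq_abs, abs_mul, abs_of_pos (mul_pos hs hσn),
              norm_inv, Real.norm_natCast, hQ, mul_assoc |a|]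
            gcongr
            refine norm_sum_le_of_le _ fun i _ => ?_
            rw [norm_smul, Real.norm_eq_abs, abs_of_nonneg (sq_nonneg _)]
            gcongr
            exact hJM i
        have hZ : ‖q • (θhat n ω - θ₀) - T n (q • F n ω θ₀)‖ ≤ C₅ * η * ‖q • F n ω θ₀‖ := by
          rw [map_smul, ← smul_sub, norm_smul, norm_smul, Real.norm_eq_abs, abs_of_pos hq0]
          calc _ ≤ q * (C₅ * η * ‖F n ω θ₀‖) := by gcongr
            _ = _ := by ring
        refine (norm_sub_map_le hTLn hC hC₅0 hη0.le (hη2.trans (by norm_num)) hQnn hUV hZ).trans ?_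
        have hQeq : (|a| + 1) * (√(n : ℝ) * σ n) * ((n : ℝ)⁻¹ *
            ∑ i ∈ Finset.range n, ε i ω ^ 2 * M i) = (|a| + 1) * Q := by rw [hQ]; ring
        beta_reduce
        rw [hQeq, ← hC₃]
        refine mul_le_mul_of_nonneg_left ?_ (mul_nonneg hC₃0 hη0.le)
        linarith only [hVn]
    have hsum := TendstoInMeasure.add_zero hrem hTV
    refine hsum.congr_left fun n => ae_of_all _ fun ω => ?_
    simp only [Pi.add_apply, Pi.sub_apply]
    abel

end Main

end PropErr

open PropErr in
theorem mainTheorem6 {X Ω : Type*} [MeasurableSpace Ω] (μ : Measure Ω) [IsProbabilityMeasure μ]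
    {p : ℕ} (f : X → PropErr.Par p → ℝ) (x : ℕ → X) (θ₀ : PropErr.Par p)
    (ε : ℕ → Ω → ℝ) (hε_meas : ∀ i, Measurable (ε i)) (hε_indep : iIndepFun ε μ)
    (hε_ident : ∀ i, IdentDistrib (ε i) (ε 0) μ μ) (hε_L2 : MemLp (ε 0) 2 μ)
    (hε_mean : ∫ ω, ε 0 ω ∂μ = 0) (hε_var : ∫ ω, ε 0 ω ^ 2 ∂μ = 1)
    (hreg : PropErr.Regular f x θ₀)
    (σ : ℕ → ℝ) (hσ : ∀ n, 0 < σ n)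
    (δ : ℝ) (hδ : Tendsto (fun n : ℕ => √(n : ℝ) * σ n) atTop (𝓝 δ))
    (S : Matrix (Fin p) (Fin p) ℝ) (Γ₁ Γ₂ Γ₃ : PropErr.Par p)
    (hgram : ∀ᶠ n in atTop, IsUnit (PropErr.gram f x θ₀ n).det)
    (hS : Tendsto (fun n : ℕ => ((n : ℝ)⁻¹ • PropErr.gram f x θ₀ n)⁻¹) atTop (𝓝 S))
    (hΓ₁ : Tendsto (fun n : ℕ => (n : ℝ)⁻¹ •
      ∑ i ∈ Finset.range n, PropErr.relGrad f x θ₀ i) atTop (𝓝 Γ₁))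
    (hΓ₂ : Tendsto (fun n : ℕ => (n : ℝ)⁻¹ •
      ∑ i ∈ Finset.range n, PropErr.w₁ f x θ₀ n i • PropErr.relGrad f x θ₀ i) atTop (𝓝 Γ₂))
    (hΓ₃ : Tendsto (fun n : ℕ => (n : ℝ)⁻¹ •
      ∑ i ∈ Finset.range n, PropErr.w₂ f x θ₀ n i • PropErr.relGrad f x θ₀ i) atTop (𝓝 Γ₃)) :
    PropErr.RootsTendToMVN μ
      (fun n ω => PropErr.wlsScore f x (PropErr.response f x θ₀ (σ n) fun i => ε i ω) n) θ₀ σ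
      (δ • Matrix.toEuclideanCLM (n := Fin p) (𝕜 := ℝ) S (Γ₁ - Γ₂ - (1 / 2 : ℝ) • Γ₃)) S ∧
    PropErr.RootsTendToMVN μ
      (fun n ω => PropErr.dwlsScore f x (PropErr.response f x θ₀ (σ n) fun i => ε i ω) n) θ₀ σ
      (δ • Matrix.toEuclideanCLM (n := Fin p) (𝕜 := ℝ) S
        ((-2 : ℝ) • Γ₁ + (2 : ℝ) • Γ₂ - (1 / 2 : ℝ) • Γ₃)) S := by
  obtain ⟨ρ, c, M, N, K, hmod, hhess⟩ := hreg.exists_localModel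
  have hJ : ∀ i, ‖relGrad f x θ₀ i‖ ≤ M i := hmod.norm_center_le
  -- The entries of `J_i J_iᵀ` are at most `M i ^ 2`, so the sum to be controlled is exactly `∑ M i
  -- ^ 3`.
  have hΓ₂0 : Γ₂ = 0 := by
    refine tendsto_nhds_unique hΓ₂ (tendsto_weighted_trace_zero (k := fun i => M i ^ 2) (M := M)
      (D := K) (fun i => sq_nonneg _) (fun i a b => ?_) hJ ?_ hgram hS)
    · rw [Matrix.vecMulVec_apply, abs_mul, sq]
      have h := fun j : Fin p => (PiLp.norm_apply_le (relGrad f x θ₀ i) j).trans (hJ i)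
      simp only [Real.norm_eq_abs] at h
      have := hmod.hM i
      gcongr
      · exact h a
      · exact h b
    · filter_upwards [hmod.sum_M] with n hn
      simpa only [← pow_succ] using hn
  have hΓ₃0 : Γ₃ = 0 := by
    refine tendsto_nhds_unique hΓ₃ (tendsto_weighted_trace_zero (k := N) (M := M)
      (D := K) hmod.hN hhess hJ ?_ hgram hS)
    filter_upwards [hmod.sum_N] with n hn
    refine (Finset.sum_le_sum fun i _ => ?_).trans hn
    linarith [hmod.hN i]
  subst hΓ₂0 hΓ₃0
  obtain ⟨C, hwls⟩ := wlsKernel_scoreKernel hmod.hc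
  constructor
  · have := rootsTendToMVN_of_kernel hε_meas hε_indep hε_ident hε_L2 hε_mean hε_var hmod hwls hσ hδ
      hgram hS hΓ₁ (Ψ := fun n ω =>
        wlsScore f x (response f x θ₀ (σ n) fun i => ε i ω) n) fun n ω θ hθ =>
        wlsScore_eq hreg.1 fun i => (hmod.hc.trans_le (hmod.g_ge i θ hθ)).ne'
    simpa using this
  · have := rootsTendToMVN_of_kernel hε_meas hε_indep hε_ident hε_L2 hε_mean hε_var hmod
      (dwlsKernel_scoreKernel c) hσ hδ hgram hS hΓ₁ (Ψ := fun n ω =>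
        dwlsScore f x (response f x θ₀ (σ n) fun i => ε i ω) n) fun n ω θ _ => dwlsScore_eq hreg.1
    simpa using this
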